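/- Let $Q$ be a smooth ($C^\infty$), Hausdorff, second countable finite-dimensional real manifold, let $k\ge 0$, and let $T^1_kQ=TQ\oplus_Q\overset{k}{\cdots}\oplus_Q TQ$ and $(T^1_k)^*Q=T^*Q\oplus_Q\overset{k}{\cdots}\oplus_Q T^*Q$, with projection $\pi:T^1_kQ\to Q$. For $\mathbf v=(q;v_1,\dots,v_k)\in T^1_kQ$ and $u\in T_qQ$ let $u^{\wedge\alpha}_{\mathbf v}=\frac{d}{dt}\big|_{t=0}(q;v_1,\dots,v_\alpha+tu,\dots,v_k)$, and put $J^\alpha_{\mathbf v}(X)=(T_{\mathbf v}\pi(X))^{\wedge\alpha}_{\mathbf v}$ and $\Delta_{\mathbf v}=\sum_\alpha (v_\alpha)^{\wedge\alpha}_{\mathbf v}$. For a smooth $\mathcal L:T^1_kQ\to\mathbb R$ let $\theta^\alpha_{\mathcal L}=d\mathcal L\circ J^\alpha$, $\omega^\alpha_{\mathcal L}=-d\theta^\alpha_{\mathcal L}$, $\mathcal E_{\mathcal L}=\Delta(\mathcal L)-\mathcal L$, and let $\mathcal{FL}:T^1_kQ\to (T^1_k)^*Q$ be the Legendre map, $\mathcal{FL}(\mathbf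 v)^\alpha(u)=\frac{d}{ds}\big|_{s=0}\mathcal L(q;v_1,\dots,v_\alpha+su,\dots,v_k)$. Assume that $\mathcal L$ is almost-regular: $P_0=\mathcal{FL}(T^1_kQ)$ is a closed embedded submanifold of $(T^1_k)^*Q$, the induced map $\mathcal{FL}_0:T^1_kQ\to P_0$ is a submersion, and $\mathcal{FL}^{-1}(p)$ is connected for every $p\in P_0$ (whether $\mathcal L$ is singular is irrelevant). Let $\mathcal K=\bigcap_\alpha \mathrm{Ker}\,\omega^\alpha_{\mathcal L}$ be the set of smooth vector fields $Z$ on $T^1_kQ$ with $i(Z)\omega^\alpha_{\mathcal L}=0$ for all $\alpha$; the functions $\zeta^{(Z)}_1=i(Z)d\mathcal E_{\mathcal L}$, $Z\in\mathcal K$, are the first-generation dynamical constraints. A function on $T^1_kQ$ is called $\mathcal{FL}$-projectable if it equals $g\circ\mathcal{FL}_0$ for some $g\in C^\infty(P_0)$; a vector field on $T^1_kQ$ is called $\mathcal{FL}$-projectable if it is $\mathcal{FL}_0$-related to a smooth vector field on $P_0$. A finite family in $\mathcal K$ is said to generate $\mathcal K$ on an open set $U$ if on $U$ every element of $\mathcal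 K$ is a linear combination of the family with coefficients in $C^\infty(U)$. Then the dynamical constraints can be chosen to be $\mathcal{FL}$-projectable functions, in the following sense. 1. If $Z\in\mathcal K$ is $\mathcal{FL}$-projectable, then the function $\zeta^{(Z)}_1$ is $\mathcal{FL}$-projectable. 2. For every $Z\in\mathcal K$ and every $\mathbf v\in T^1_kQ$ there is an $\mathcal{FL}$-projectable $Z'\in\mathcal K$ with $Z'_{\mathbf v}=Z_{\mathbf v}$ for which $\zeta_1^{(Z')}$ is $\mathcal{FL}$-projectable. 3. The set of common zeros of all the functions $\zeta^{(Z)}_1$, $Z\in\mathcal K$, equals the set of common zeros of those among them that are $\mathcal{FL}$-projectable. 4. Whenever $\mathcal K$ is generated on an open neighbourhood $U$ of a point $\mathbf v$ by $r$ elements (for instance, when $\bigcap_\alpha\mathrm{Ker}(\omega^\alpha_{\mathcal L})$ has constant rank near $\mathbf v$), there are an open neighbourhood $U'\subseteq U$ of $\mathbf v$ and $\mathcal{FL}$-projectable $W_1,\dots,W_r\in\mathcal K$ that generate $\mathcal K$ on $U'$. Their constraints $\zeta^{(W_i)}_1$ are $\mathcal{FL}$-projectable, and on $U'$ every constraint $\zeta^{(Z)}_1$,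 $Z\in\mathcal K$, is a linear combination $\sum_i c_i\,\zeta^{(W_i)}_1$ with $c_i\in C^\infty(U')$. -/

import Mathlib

open Set Manifold Topology
open scoped ContDiff Bundle

namespace KSymplectic

noncomputable section

/-! ### The `k`-tangent and `k`-cotangent bundles

`Q` is a manifold modelled on the finite-dimensional real vector space `E`. Both bundles are glued
from the transition functions of the tangent bundle `TQ`, acting on each of the `k` summands. -/

section Bundles

variable {E : Type*} [NormedAddCommGroup E] [NormedSpace ℝ E] [FiniteDimensional ℝ E]
variable (k : ℕ) (Q : Type*) [TopologicalSpace Q] [ChartedSpace E Q]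

/-- The endomorphism `A ⊕ ⋯ ⊕ A` of `V ⊕ ⋯ ⊕ V` (`k` summands), as a function of `A`. -/
def copies (V : Type*) [NormedAddCommGroup V] [NormedSpace ℝ V] [FiniteDimensional ℝ V] :
    (V →L[ℝ] V) →L[ℝ] ((Fin k → V) →L[ℝ] (Fin k → V)) :=
  LinearMap.toContinuousLinearMap
    { toFun := fun A => ContinuousLinearMap.pi fun a => A.comp (ContinuousLinearMap.proj a)
      map_add' := fun _ _ => rfl
      map_smul' := fun _ _ => rfl }

/-- The transpose `A ↦ (p ↦ p ∘ A)` of endomorphisms of `E`. -/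
def transpose (E : Type*) [NormedAddCommGroup E] [NormedSpace ℝ E] :
    (E →L[ℝ] E) →L[ℝ] ((E →L[ℝ] ℝ) →L[ℝ] (E →L[ℝ] ℝ)) :=
  (ContinuousLinearMap.compL ℝ E E ℝ).flip

/-- Gluing data of `T¹ₖQ = TQ ⊕ ⋯ ⊕ TQ` (`k` summands): the typical fibre is `E ⊕ ⋯ ⊕ E`, and the
transition functions are those of `TQ` in each component. -/
def kTangentCore [IsManifold 𝓘(ℝ, E) 1 Q] :
    VectorBundleCore ℝ Q (Fin k → E) (atlas E Q) where
  baseSet := (tangentBundleCore 𝓘(ℝ, E) Q).baseSet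
  isOpen_baseSet := (tangentBundleCore 𝓘(ℝ, E) Q).isOpen_baseSet
  indexAt := (tangentBundleCore 𝓘(ℝ, E) Q).indexAt
  mem_baseSet_at := (tangentBundleCore 𝓘(ℝ, E) Q).mem_baseSet_at
  coordChange i j x := copies k E ((tangentBundleCore 𝓘(ℝ, E) Q).coordChange i j x)
  coordChange_self i x hx v := by
    ext1 a
    exact (tangentBundleCore 𝓘(ℝ, E) Q).coordChange_self i x hx (v a)
  continuousOn_coordChange i j :=
    (copies k E).continuous.comp_continuousOn
      ((tangentBundleCore 𝓘(ℝ, E) Q).continuousOn_coordChange i j)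
  coordChange_comp i j l x hx v := by
    ext1 a
    exact (tangentBundleCore 𝓘(ℝ, E) Q).coordChange_comp i j l x hx (v a)

/-- Gluing data of `(T¹ₖ)*Q = T*Q ⊕ ⋯ ⊕ T*Q` (`k` summands): the typical fibre is
`E* ⊕ ⋯ ⊕ E*`, and covectors are transported by the transpose of the inverse transition functions
of `TQ` in each component. -/
def kCotangentCore [IsManifold 𝓘(ℝ, E) 1 Q] :
    VectorBundleCore ℝ Q (Fin k → (E →L[ℝ] ℝ)) (atlas E Q) where
  baseSet := (tangentBundleCore 𝓘(ℝ, E) Q).baseSet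
  isOpen_baseSet := (tangentBundleCore 𝓘(ℝ, E) Q).isOpen_baseSet
  indexAt := (tangentBundleCore 𝓘(ℝ, E) Q).indexAt
  mem_baseSet_at := (tangentBundleCore 𝓘(ℝ, E) Q).mem_baseSet_at
  coordChange i j x :=
    copies k (E →L[ℝ] ℝ) (transpose E ((tangentBundleCore 𝓘(ℝ, E) Q).coordChange j i x))
  coordChange_self i x hx p := by
    ext a u
    exact congrArg (p a) ((tangentBundleCore 𝓘(ℝ, E) Q).coordChange_self i x hx u)
  continuousOn_coordChange i j :=
    (copies k (E →L[ℝ] ℝ)).continuous.comp_continuousOn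
      ((transpose E).continuous.comp_continuousOn
        (((tangentBundleCore 𝓘(ℝ, E) Q).continuousOn_coordChange j i).mono
          (inter_comm _ _).subset))
  coordChange_comp i j l x hx p := by
    ext a u
    exact congrArg (p a)
      ((tangentBundleCore 𝓘(ℝ, E) Q).coordChange_comp l j i x ⟨⟨hx.2, hx.1.2⟩, hx.1.1⟩ u)

instance kTangentCore_isContMDiff [IsManifold 𝓘(ℝ, E) 1 Q] [IsManifold 𝓘(ℝ, E) ∞ Q] :
    (kTangentCore (E := E) k Q).IsContMDiff 𝓘(ℝ, E) ∞ where
  contMDiffOn_coordChange i j := by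
    have : IsManifold 𝓘(ℝ, E) (∞ + 1) Q := ‹IsManifold 𝓘(ℝ, E) ∞ Q›
    have : (tangentBundleCore 𝓘(ℝ, E) Q).IsContMDiff 𝓘(ℝ, E) ∞ := tangentBundleCore.isContMDiff
    exact (copies k E).contMDiff.comp_contMDiffOn
      ((tangentBundleCore 𝓘(ℝ, E) Q).contMDiffOn_coordChange 𝓘(ℝ, E) i j)

theorem contMDiffOn_clm_comp {E Q : Type*} [NormedAddCommGroup E] [NormedSpace ℝ E]
    [TopologicalSpace Q] [ChartedSpace E Q]
    {A B : Type*} [NormedAddCommGroup A] [NormedSpace ℝ A] [NormedAddCommGroup B] [NormedSpace ℝ B]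
    (T : A →L[ℝ] B) {f : Q → A} {s : Set Q} (hf : ContMDiffOn 𝓘(ℝ, E) 𝓘(ℝ, A) ∞ f s) :
    ContMDiffOn 𝓘(ℝ, E) 𝓘(ℝ, B) ∞ (fun x => T (f x)) s :=
  T.contMDiff.comp_contMDiffOn hf

set_option synthInstance.maxHeartbeats 200000 in
instance kCotangentCore_isContMDiff [IsManifold 𝓘(ℝ, E) 1 Q] [IsManifold 𝓘(ℝ, E) ∞ Q] :
    (kCotangentCore (E := E) k Q).IsContMDiff 𝓘(ℝ, E) ∞ where
  contMDiffOn_coordChange i j := by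
    have : IsManifold 𝓘(ℝ, E) (∞ + 1) Q := ‹IsManifold 𝓘(ℝ, E) ∞ Q›
    have : (tangentBundleCore 𝓘(ℝ, E) Q).IsContMDiff 𝓘(ℝ, E) ∞ := tangentBundleCore.isContMDiff
    have h := ((tangentBundleCore 𝓘(ℝ, E) Q).contMDiffOn_coordChange (n := ∞) 𝓘(ℝ, E) j i).mono
      (inter_comm _ _).subset
    have h' := contMDiffOn_clm_comp (B := (E →L[ℝ] ℝ) →L[ℝ] (E →L[ℝ] ℝ)) (transpose E) h
    exact contMDiffOn_clm_comp
      (B := (Fin k → (E →L[ℝ] ℝ)) →L[ℝ] (Fin k → (E →L[ℝ] ℝ))) (copies k (E →L[ℝ] ℝ)) h'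

/-- The `k`-tangent bundle `T¹ₖQ`; its points are `⟨q, v⟩` with `v α ∈ T_q Q` for `α : Fin k`
(as for Mathlib's `TangentSpace`, `T_q Q` is identified with `E` by the preferred chart at `q`). -/
abbrev KTangentBundle [IsManifold 𝓘(ℝ, E) 1 Q] : Type _ :=
  Bundle.TotalSpace (Fin k → E) (kTangentCore (E := E) k Q).Fiber

/-- The `k`-cotangent bundle `(T¹ₖ)*Q`; its points are `⟨q, p⟩` with `p α ∈ T*_q Q`. -/
abbrev KCotangentBundle [IsManifold 𝓘(ℝ, E) 1 Q] : Type _ :=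
  Bundle.TotalSpace (Fin k → (E →L[ℝ] ℝ)) (kCotangentCore (E := E) k Q).Fiber

end Bundles

/-- The model of the manifold `T¹ₖQ`. -/
abbrev modelT (E : Type*) [NormedAddCommGroup E] [NormedSpace ℝ E] (k : ℕ) :=
  (𝓘(ℝ, E)).prod 𝓘(ℝ, Fin k → E)

/-- The model of the manifold `(T¹ₖ)*Q`. -/
abbrev modelT' (E : Type*) [NormedAddCommGroup E] [NormedSpace ℝ E] (k : ℕ) :=
  (𝓘(ℝ, E)).prod 𝓘(ℝ, Fin k → (E →L[ℝ] ℝ))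

/-! ### Exterior derivative of a 1-form on a manifold -/

section ExteriorDerivative

variable {V : Type*} [NormedAddCommGroup V] [NormedSpace ℝ V]
  {H : Type*} [TopologicalSpace H] (I : ModelWithCorners ℝ V H)
  {M : Type*} [TopologicalSpace M] [ChartedSpace H M]

/-- The exterior derivative `(dθ)_x(u, w)` of a 1-form `θ` on a manifold without boundary:
write `θ` in the preferred chart `φ` at `x`, take the exterior derivative in the model vector
space at `φ x`, and evaluate it on the images of `u` and `w` under `T_x φ`. -/
def extDerivOneForm (θ : ∀ x : M, TangentSpace I x →L[ℝ] ℝ) (x : M) (u w : TangentSpace I x) : ℝ :=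
  extDeriv
    (fun y : V => ContinuousAlternatingMap.ofSubsingleton ℝ V ℝ (0 : Fin 1)
      ((θ ((extChartAt I x).symm y)).comp (mfderiv 𝓘(ℝ, V) I (extChartAt I x).symm y)))
    (extChartAt I x x)
    ![mfderiv I 𝓘(ℝ, V) (extChartAt I x) x u, mfderiv I 𝓘(ℝ, V) (extChartAt I x) x w]

end ExteriorDerivative

/-! ### Smooth vector fields and projectability -/

section Projectable

variable {V : Type*} [NormedAddCommGroup V] [NormedSpace ℝ V]
  {H : Type*} [TopologicalSpace H] (I : ModelWithCorners ℝ V H)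
  {M : Type*} [TopologicalSpace M] [ChartedSpace H M]
  {V' : Type*} [NormedAddCommGroup V'] [NormedSpace ℝ V']
  {H' : Type*} [TopologicalSpace H'] (I' : ModelWithCorners ℝ V' H')
  {N : Type*} [TopologicalSpace N] [ChartedSpace H' N]

/-- `X` is a (smooth) vector field on `M`. -/
def IsSmoothVectorField [IsManifold I 1 M] (X : ∀ x : M, TangentSpace I x) : Prop :=
  ContMDiff I I.tangent ∞ (fun x => (⟨x, X x⟩ : TangentBundle I M))

/-- A function `f` on `M` is projectable along `F : M → N` if it is the pull-back `F^* g` of a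
smooth function `g` on `N`. -/
def IsProjectableFunction (F : M → N) (f : M → ℝ) : Prop :=
  ∃ g : N → ℝ, ContMDiff I' 𝓘(ℝ, ℝ) ∞ g ∧ f = g ∘ F

/-- A vector field `X` on `M` is projectable along `F : M → N` if it is `F`-related to a smooth
vector field on `N`. -/
def IsProjectableVectorField [IsManifold I' 1 N] (F : M → N) (X : ∀ x : M, TangentSpace I x) :
    Prop :=
  ∃ Y : ∀ y : N, TangentSpace I' y, IsSmoothVectorField I' Y ∧
    ∀ x, mfderiv I I' F x (X x) = Y (F x)

end Projectable

/-! ### The Lagrangian formalism -/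

section Lagrangian

variable {E : Type*} [NormedAddCommGroup E] [NormedSpace ℝ E] [FiniteDimensional ℝ E]
variable {k : ℕ} {Q : Type*} [TopologicalSpace Q] [ChartedSpace E Q] [IsManifold 𝓘(ℝ, E) ∞ Q]

/-- The derivative at `v = (q; v₁, …, vₖ)` of the inclusion of the fibre of `T¹ₖQ` over `q`. -/
def fiberDeriv (v : KTangentBundle (E := E) k Q) :
    (Fin k → E) →L[ℝ] TangentSpace (modelT E k) v :=
  mfderiv 𝓘(ℝ, Fin k → E) (modelT E k)
    (fun w : Fin k → E => (⟨v.proj, w⟩ : KTangentBundle (E := E) k Q)) v.snd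

/-- The vertical `α`-lift `T_q Q → T_v(T¹ₖQ)` at `v = (q; v₁, …, vₖ)`, which takes `u` to the
velocity at `t = 0` of `t ↦ (q; v₁, …, v_α + t u, …, vₖ)`: it is the derivative at `v` of the
inclusion of the fibre over `q`, applied to the vector with `u` in place `α` and `0` elsewhere. -/
def verticalLift (α : Fin k) (v : KTangentBundle (E := E) k Q) :
    TangentSpace 𝓘(ℝ, E) v.proj →L[ℝ] TangentSpace (modelT E k) v :=
  (fiberDeriv v).comp (ContinuousLinearMap.single ℝ (fun _ : Fin k => E) α)

/-- The vertical endomorphism `J^α`. -/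
def verticalEndo (α : Fin k) (v : KTangentBundle (E := E) k Q) :
    TangentSpace (modelT E k) v →L[ℝ] TangentSpace (modelT E k) v :=
  (verticalLift α v).comp
    (mfderiv (modelT E k) 𝓘(ℝ, E) (fun w : KTangentBundle (E := E) k Q => w.proj) v)

/-- The Liouville vector field `Δ`. -/
def liouville (v : KTangentBundle (E := E) k Q) : TangentSpace (modelT E k) v :=
  ∑ α : Fin k, verticalLift α v (v.snd α)

/-- The differential of a function on `T¹ₖQ`. -/
def differential (f : KTangentBundle (E := E) k Q → ℝ) (v : KTangentBundle (E := E) k Q) :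
    TangentSpace (modelT E k) v →L[ℝ] ℝ :=
  mfderiv (modelT E k) 𝓘(ℝ, ℝ) f v

/-- The Cartan 1-form `θ^α_L = dL ∘ J^α`. -/
def cartanOneForm (L : KTangentBundle (E := E) k Q → ℝ) (α : Fin k)
    (v : KTangentBundle (E := E) k Q) : TangentSpace (modelT E k) v →L[ℝ] ℝ :=
  (differential L v).comp (verticalEndo α v)

/-- The Cartan 2-form `ω^α_L = -dθ^α_L`. -/
def cartanTwoForm (L : KTangentBundle (E := E) k Q → ℝ) (α : Fin k)
    (v : KTangentBundle (E := E) k Q) (u w : TangentSpace (modelT E k) v) : ℝ :=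
  -extDerivOneForm (modelT E k) (cartanOneForm L α) v u w

/-- The Lagrangian energy `E_L = Δ(L) - L`. -/
def energy (L : KTangentBundle (E := E) k Q → ℝ) (v : KTangentBundle (E := E) k Q) : ℝ :=
  differential L v (liouville v) - L v

/-- The Legendre map `FL : T¹ₖQ → (T¹ₖ)*Q`: the `α`-component of `FL(q; v)` takes `u ∈ T_q Q` to the
derivative at `s = 0` of `s ↦ L(q; v₁, …, v_α + s u, …, vₖ)`, that is, to the derivative of the
restriction of `L` to the fibre over `q`, in the direction of `u` placed in component `α`. -/
def legendre (L : KTangentBundle (E := E) k Q → ℝ) (v : KTangentBundle (E := E) k Q) :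
    KCotangentBundle (E := E) k Q :=
  ⟨v.proj, fun α =>
    (fderiv ℝ (fun w : Fin k → E => L ⟨v.proj, w⟩) v.snd).comp
      (ContinuousLinearMap.single ℝ (fun _ : Fin k => E) α)⟩

/-- The Legendre map onto its image, `FL₀ : T¹ₖQ → P₀ = FL(T¹ₖQ)`. -/
def legendre₀ (L : KTangentBundle (E := E) k Q → ℝ) :
    KTangentBundle (E := E) k Q → range (legendre L) :=
  rangeFactorization (legendre L)

/-- `L` is almost-regular, where `P₀ = FL(T¹ₖQ)` carries the manifold structure given by the
instance arguments: `P₀` is a closed (embedded) submanifold of `(T¹ₖ)*Q`, the map `FL₀` is a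
submersion onto it, and the fibres of `FL` over points of `P₀` are connected (as fibres of a
submersion they are then submanifolds). Singularity of `L` is not imposed. -/
structure IsAlmostRegular (L : KTangentBundle (E := E) k Q → ℝ)
    (E₀ : Type*) [NormedAddCommGroup E₀] [NormedSpace ℝ E₀]
    [ChartedSpace E₀ (range (legendre L))] : Prop where
  contMDiff : ContMDiff (modelT E k) 𝓘(ℝ, ℝ) ∞ L
  isClosed_range : IsClosed (range (legendre L))
  isSmoothEmbedding : IsSmoothEmbedding 𝓘(ℝ, E₀) (modelT' E k) ∞
    (Subtype.val : range (legendre L) → KCotangentBundle (E := E) k Q)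
  isSubmersion : IsSubmersion (modelT E k) 𝓘(ℝ, E₀) ∞ (legendre₀ L)
  isConnected_fiber : ∀ p ∈ range (legendre L), IsConnected (legendre L ⁻¹' {p})

/-- The vector fields `Z` on `T¹ₖQ` in `⋂_α Ker ω^α_L`, i.e. with `i(Z) ω^α_L = 0` for all `α`. -/
def cartanKernel (L : KTangentBundle (E := E) k Q → ℝ) :
    Set (∀ v : KTangentBundle (E := E) k Q, TangentSpace (modelT E k) v) :=
  {Z | IsSmoothVectorField (modelT E k) Z ∧ ∀ α v w, cartanTwoForm L α v (Z v) w = 0}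

/-- The function `ζ₁^(Z) = i(Z) dE_L`; for `Z` in `cartanKernel L` these are the first-generation
dynamical constraints. -/
def dynamicalConstraint (L : KTangentBundle (E := E) k Q → ℝ)
    (Z : ∀ v : KTangentBundle (E := E) k Q, TangentSpace (modelT E k) v)
    (v : KTangentBundle (E := E) k Q) : ℝ :=
  differential (energy L) v (Z v)

/-- The finite family `Z` generates the vector fields of `⋂_α Ker ω^α_L` on `U`: it consists of
such fields, and each such field is on `U` a combination of them with smooth coefficients. -/
def GeneratesKernelOn (L : KTangentBundle (E := E) k Q → ℝ) {r : ℕ}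
    (Z : Fin r → ∀ v : KTangentBundle (E := E) k Q, TangentSpace (modelT E k) v)
    (U : Set (KTangentBundle (E := E) k Q)) : Prop :=
  (∀ i, Z i ∈ cartanKernel L) ∧
    ∀ X ∈ cartanKernel L, ∃ c : Fin r → KTangentBundle (E := E) k Q → ℝ,
      (∀ i, ContMDiffOn (modelT E k) 𝓘(ℝ, ℝ) ∞ (c i) U) ∧
      ∀ v ∈ U, X v = ∑ i, c i v • Z i v

end Lagrangian

end

end KSymplectic

namespace KSymplectic

/-! ### Calculus in vector spaces: parameter integrals, Hadamard's lemma, local extension -/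

section Calculus

variable {X W : Type*} [NormedAddCommGroup X] [NormedSpace ℝ X] [FiniteDimensional ℝ X]
  [NormedAddCommGroup W] [NormedSpace ℝ W]

/-! The Legendre map pulls the canonical 2-forms of the `k`-cotangent bundle back to the Cartan
2-forms (`cartanTwoForm_eq`), and it factors as the submersion `legendre₀ L` onto `P₀` followed by
the inclusion. The differential of a submersion is onto every tangent space, so a smooth field lies
in the kernel exactly when its image at each point lies in the subspace `D_p` of `T_p P₀`
annihilated by the restricted canonical forms (`cartanKernel_eq`). This subspace depends only on the
point `p` of `P₀`; its dimension may jump.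

The differential of the energy vanishes on the kernel of the differential of the Legendre map,
because the momenta are the fibre derivatives of `L`. As the fibres are connected, the energy is the
pull-back of a smooth `g` on `P₀`. If `Z` projects to `Y`, its constraint is the pull-back of
`Y(g)`: this is the first claim.

The other claims rest on `exists_projectable_add_sum`. In charts where the submersion is `(a, b) ↦
a`, the base component of a kernel field `Z` is a function `f(a, b)` with values in `D_a`. Freezing
`b = b₀` gives a field on the base with values in `D`. In Hadamard's expansion `f(a, b) - f(a, b₀) =
∑ (b - b₀)_j h_j(a, b)` the `h_j(a, b)` are averages of `b`-derivatives of a map into the fixed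
linear space `D_a`, so they lie in `D_a` too. Hence near the chosen point `Z = W + ∑ β_j h_j` with
`W` projectable, all `h_j` in the kernel, and the `β_j` vanishing at the point. Evaluation there
gives the second claim, and with it the third. If the `Z_i` generate, expanding the `h_j` in them
gives `W = A Z` with `A = 1` at the point; as in Nakayama's lemma, `A` is invertible nearby and the
`W_i` generate as well. -/

theorem hasFDerivAt_unitIntegral [CompleteSpace W] {g : X × ℝ → W} (hg : ContDiff ℝ 1 g) (x₀ : X) :
    HasFDerivAt (fun x => ∫ t in (0 : ℝ)..1, g (x, t))
      (∫ t in (0 : ℝ)..1, (fderiv ℝ g (x₀, t)).comp (ContinuousLinearMap.inl ℝ X ℝ)) x₀ := by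
  have hd : Differentiable ℝ g := hg.differentiable one_ne_zero
  have hc : Continuous fun p : X × ℝ => (fderiv ℝ g p).comp (ContinuousLinearMap.inl ℝ X ℝ) :=
    (hg.continuous_fderiv one_ne_zero).clm_comp continuous_const
  -- In finite dimension the closed ball is compact, so one constant dominates the `x`-derivative
  -- for all parameters near `x₀` and all `t` in `[0, 1]`.
  obtain ⟨C, hC⟩ := ((isCompact_closedBall x₀ 1).prod
    (isCompact_Icc (a := (0 : ℝ)) (b := 1))).exists_bound_of_continuousOn hc.continuousOn
  refine (intervalIntegral.hasFDerivAt_integral_of_dominated_of_fderiv_le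
    (F' := fun x t => (fderiv ℝ g (x, t)).comp (ContinuousLinearMap.inl ℝ X ℝ))
    (bound := fun _ => C) (Metric.closedBall_mem_nhds x₀ one_pos) ?_ ?_ ?_ ?_ ?_ ?_)
  · exact .of_forall fun x =>
      (hg.continuous.comp (Continuous.prodMk_right x)).aestronglyMeasurable
  · exact (hg.continuous.comp (Continuous.prodMk_right x₀)).intervalIntegrable _ _
  · exact (hc.comp (Continuous.prodMk_right x₀)).aestronglyMeasurable
  · refine .of_forall fun t ht x hx => hC (x, t) ⟨hx, ?_⟩
    rw [uIoc_of_le zero_le_one] at ht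
    exact Ioc_subset_Icc_self ht
  · exact intervalIntegrable_const
  · refine .of_forall fun t _ x _ => ?_
    exact (hd (x, t)).hasFDerivAt.comp x (hasFDerivAt_prodMk_left x t)

/-- Each directional derivative of the integral is again the unit integral of a smooth function, so
induction on the order works with `g` generalized. -/
theorem contDiff_unitIntegral [CompleteSpace W] {g : X × ℝ → W} (hg : ContDiff ℝ ∞ g) :
    ContDiff ℝ ∞ fun x => ∫ t in (0 : ℝ)..1, g (x, t) := by
  refine contDiff_infty.2 fun n => ?_
  induction n generalizing g with
  | zero =>
    refine contDiff_zero.2 (continuous_iff_continuousAt.2 fun x => ?_)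
    exact (hasFDerivAt_unitIntegral (hg.of_le (by simp)) x).continuousAt
  | succ n ih =>
    have h1 : ContDiff ℝ 1 g := hg.of_le (by simp)
    push_cast
    refine contDiff_succ_iff_fderiv_apply.2
      ⟨fun x => (hasFDerivAt_unitIntegral h1 x).differentiableAt, by simp, fun y => ?_⟩
    have heq : (fun x => fderiv ℝ (fun x => ∫ t in (0 : ℝ)..1, g (x, t)) x y) =
        fun x => ∫ t in (0 : ℝ)..1, fderiv ℝ g (x, t) (y, 0) := by
      ext x
      rw [(hasFDerivAt_unitIntegral h1 x).fderiv, ContinuousLinearMap.intervalIntegral_apply]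
      · simp
      · refine Continuous.intervalIntegrable ?_ _ _
        exact ((h1.continuous_fderiv one_ne_zero).clm_comp continuous_const).comp
          (Continuous.prodMk_right x)
    rw [heq]
    exact ih (g := fun p => fderiv ℝ g p (y, 0))
      ((hg.fderiv_right (by simp)).clm_apply contDiff_const)

/-- **Hadamard's lemma** with parameters. The remainder terms inherit the linear equations which
`f (a, ·)` satisfies on a convex open set. -/
theorem exists_hadamard [CompleteSpace W] {A B : Type*} [NormedAddCommGroup A] [NormedSpace ℝ A]
    [FiniteDimensional ℝ A] [NormedAddCommGroup B] [NormedSpace ℝ B] [FiniteDimensional ℝ B]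
    {ι : Type*} [Fintype ι] (e : Module.Basis ι ℝ B) {f : A × B → W} (hf : ContDiff ℝ ∞ f) (b₀ : B) :
    ∃ h : ι → A × B → W, (∀ j, ContDiff ℝ ∞ (h j)) ∧
      (∀ a b, f (a, b) - f (a, b₀) = ∑ j, e.repr (b - b₀) j • h j (a, b)) ∧
      ∀ (l : W →L[ℝ] ℝ) (s : Set B) (a : A), IsOpen s → Convex ℝ s → b₀ ∈ s →
        (∀ b ∈ s, l (f (a, b)) = 0) → ∀ b ∈ s, ∀ j, l (h j (a, b)) = 0 := by
  have hfd : Differentiable ℝ f := hf.differentiable (by simp)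
  have hfd' : ContDiff ℝ ∞ (fderiv ℝ f) := hf.fderiv_right (by simp)
  have hγ : ContDiff ℝ ∞ fun p : (A × B) × ℝ => (p.1.1, b₀ + p.2 • (p.1.2 - b₀)) := by fun_prop
  have hg : ∀ j, ContDiff ℝ ∞ fun p : (A × B) × ℝ =>
      fderiv ℝ f (p.1.1, b₀ + p.2 • (p.1.2 - b₀)) ((0 : A), e j) := fun j =>
    (hfd'.comp hγ).clm_apply contDiff_const
  have hgc : ∀ (x : A × B) j, Continuous fun t : ℝ =>
      fderiv ℝ f (x.1, b₀ + t • (x.2 - b₀)) ((0 : A), e j) := fun x j =>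
    (hg j).continuous.comp (Continuous.prodMk_right x)
  -- The `j`-th remainder is the average of the `j`-th partial derivative over the segment from `b₀`
  -- to `b`; the fundamental theorem of calculus along that segment gives the expansion.
  refine ⟨fun j x => ∫ t in (0 : ℝ)..1, fderiv ℝ f (x.1, b₀ + t • (x.2 - b₀)) ((0 : A), e j),
    fun j => contDiff_unitIntegral (hg j), fun a b => ?_, ?_⟩
  · have hder : ∀ t : ℝ, HasDerivAt (fun t : ℝ => f (a, b₀ + t • (b - b₀)))
        (∑ j, e.repr (b - b₀) j • fderiv ℝ f (a, b₀ + t • (b - b₀)) ((0 : A), e j)) t := by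
      intro t
      have h1 : HasDerivAt (fun t : ℝ => (a, b₀ + t • (b - b₀))) ((0 : A), b - b₀) t := by
        refine (hasDerivAt_const t a).prodMk ?_
        simpa using ((hasDerivAt_id t).smul_const (b - b₀)).const_add b₀
      have h2 := (hfd (a, b₀ + t • (b - b₀))).hasFDerivAt.comp_hasDerivAt t h1
      have h3 : ((0 : A), b - b₀) = ∑ j, e.repr (b - b₀) j • ((0 : A), e j) := by
        rw [← e.sum_repr (b - b₀)]
        ext1 <;> simp [Prod.fst_sum, Prod.snd_sum]
      rw [h3, map_sum] at h2
      simp_rw [map_smul] at h2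
      exact h2
    have := intervalIntegral.integral_eq_sub_of_hasDerivAt (a := 0) (b := 1) (fun t _ => hder t)
      ((continuous_finsetSum _ fun j _ => (hgc (a, b) j).const_smul _).intervalIntegrable _ _)
    simp only [one_smul, zero_smul, add_zero, add_sub_cancel] at this
    rw [← this, intervalIntegral.integral_finsetSum]
    · simp_rw [intervalIntegral.integral_smul]
    · exact fun j _ => ((hgc (a, b) j).const_smul _).intervalIntegrable _ _
  · intro l s a hs hconv hb₀ hl b hb j
    -- On the open set `s` the function `l (f (a, ·))` is identically zero, so `l` kills the partial
    -- derivatives there. Convexity keeps the segment inside `s`, and `l` commutes with the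
    -- integral.
    have hzero : ∀ b ∈ s, l (fderiv ℝ f (a, b) ((0 : A), e j)) = 0 := by
      intro b hb
      have h1 : HasFDerivAt (fun b => l (f (a, b)))
          (l.comp ((fderiv ℝ f (a, b)).comp (ContinuousLinearMap.inr ℝ A B))) b :=
        l.hasFDerivAt.comp b ((hfd (a, b)).hasFDerivAt.comp b (hasFDerivAt_prodMk_right a b))
      have h2 : HasFDerivAt (fun b => l (f (a, b))) (0 : B →L[ℝ] ℝ) b :=
        (hasFDerivAt_const (0 : ℝ) b).congr_of_eventuallyEq
          (Filter.eventuallyEq_of_mem (hs.mem_nhds hb) hl)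
      simpa using congrArg (fun T : B →L[ℝ] ℝ => T (e j)) (h1.unique h2)
    rw [← l.intervalIntegral_comp_comm ((hgc (a, b) j).intervalIntegrable _ _)]
    refine (intervalIntegral.integral_congr (g := fun _ => (0 : ℝ)) fun t ht => ?_).trans (by simp)
    rw [uIcc_of_le zero_le_one] at ht
    exact hzero _ (hconv.add_smul_sub_mem hb₀ hb ht)

/-- A function which is smooth near a point agrees near that point with a globally smooth one. -/
theorem exists_contDiff_eqOn_ball {f : X → W} {s : Set X} (hs : IsOpen s)
    (hf : ContDiffOn ℝ ∞ f s) {x₀ : X} (hx₀ : x₀ ∈ s) :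
    ∃ r > 0, Metric.ball x₀ r ⊆ s ∧ ∃ g : X → W, ContDiff ℝ ∞ g ∧ EqOn g f (Metric.ball x₀ r) := by
  obtain ⟨R, hR, hRs⟩ := Metric.isOpen_iff.1 hs x₀ hx₀
  -- The bump is 1 on the ball of radius `R / 3`, and its support, the closed ball of radius `R /
  -- 2`, stays inside `s`.
  let χ : ContDiffBump x₀ := ⟨R / 3, R / 2, by linarith, by linarith⟩
  refine ⟨R / 3, by linarith, (Metric.ball_subset_ball (by linarith)).trans hRs,
    fun x => χ x • f x, contDiff_iff_contDiffAt.2 fun x => ?_, fun x hx => ?_⟩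
  · by_cases hx : x ∈ s
    · exact χ.contDiffAt.smul (hf.contDiffAt (hs.mem_nhds hx))
    · have hx' : x ∉ tsupport χ := fun h => hx (hRs (by
        rw [χ.tsupport_eq] at h
        exact Metric.closedBall_subset_ball (by show R / 2 < R; linarith) h))
      refine contDiffAt_const (c := (0 : W)) |>.congr_of_eventuallyEq ?_
      filter_upwards [(isClosed_tsupport χ).isOpen_compl.mem_nhds hx'] with y hy
      rw [image_eq_zero_of_notMem_tsupport hy, zero_smul]
  · show χ x • f x = f x
    rw [χ.one_of_mem_closedBall (Metric.ball_subset_closedBall hx), one_smul]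

end Calculus

/-! ### Smooth vector fields given locally -/

section LocalFields

variable {V : Type*} [NormedAddCommGroup V] [NormedSpace ℝ V]
  {H : Type*} [TopologicalSpace H] {I : ModelWithCorners ℝ V H}
  {M : Type*} [TopologicalSpace M] [ChartedSpace H M] [IsManifold I ∞ M]
  {V' : Type*} [NormedAddCommGroup V'] [NormedSpace ℝ V']
  {H' : Type*} [TopologicalSpace H'] {J : ModelWithCorners ℝ V' H'}
  {N : Type*} [TopologicalSpace N] [ChartedSpace H' N] [IsManifold J ∞ N]
  {X : Type*} [NormedAddCommGroup X] [NormedSpace ℝ X]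

/-- The image of a smooth field of tangent vectors under the differential of a smooth map. -/
theorem contMDiffOn_mfderiv_field {f : M → N} {s : Set M} (hs : IsOpen s)
    (hf : ContMDiffOn I J ∞ f s) {P : Type*} [TopologicalSpace P] {HP VP : Type*}
    [NormedAddCommGroup VP] [NormedSpace ℝ VP] [TopologicalSpace HP] {K : ModelWithCorners ℝ VP HP}
    [ChartedSpace HP P] {φ : P → M} {Z : ∀ p, TangentSpace I (φ p)} {t : Set P}
    (hφ : MapsTo φ t s)
    (hZ : ContMDiffOn K I.tangent ∞ (fun p => (⟨φ p, Z p⟩ : TangentBundle I M)) t) :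
    ContMDiffOn K J.tangent ∞
      (fun p => (⟨f (φ p), mfderiv I J f (φ p) (Z p)⟩ : TangentBundle J N)) t := by
  have h1 := (hf.contMDiffOn_tangentMapWithin (m := ∞) (by simp) hs.uniqueMDiffOn).comp hZ
    (fun p hp => hφ hp)
  refine h1.congr fun p hp => ?_
  simp only [Function.comp, tangentMapWithin]
  rw [mfderivWithin_of_isOpen hs (hφ hp)]

/-- The derivative of a smooth vector-valued function along a smooth field is smooth. -/
theorem contMDiffOn_mfderiv_apply {f : M → X} {s : Set M} (hs : IsOpen s)
    (hf : ContMDiffOn I 𝓘(ℝ, X) ∞ f s) {Z : ∀ x : M, TangentSpace I x}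
    (hZ : ContMDiffOn I I.tangent ∞ (fun x => (⟨x, Z x⟩ : TangentBundle I M)) s) :
    ContMDiffOn I 𝓘(ℝ, X) ∞ (fun x => (mfderiv I 𝓘(ℝ, X) f x (Z x) : X)) s :=
  (contMDiff_snd_tangentBundle_modelSpace X 𝓘(ℝ, X)).comp_contMDiffOn
    (contMDiffOn_mfderiv_field hs hf (φ := id) (mapsTo_id s) hZ)

omit [IsManifold I ∞ M] in
/-- A smooth map `M → X × X` gives a smooth field of tangent vectors on `X`. -/
theorem contMDiffOn_vectorSpace_field {φ g : M → X} {s : Set M}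
    (hφ : ContMDiffOn I 𝓘(ℝ, X) ∞ φ s) (hg : ContMDiffOn I 𝓘(ℝ, X) ∞ g s) :
    ContMDiffOn I 𝓘(ℝ, X).tangent ∞
      (fun x => (⟨φ x, g x⟩ : TangentBundle 𝓘(ℝ, X) X)) s := by
  intro x hx
  refine Bundle.contMDiffWithinAt_totalSpace.2 ⟨hφ x hx, ?_⟩
  convert! hg x hx with y
  simp

/-- The vector field with components `g` in the chart `Φ`. -/
theorem contMDiffOn_field_of_chart {Φ : OpenPartialHomeomorph M X}
    (hΦ : ContMDiffOn I 𝓘(ℝ, X) ∞ Φ Φ.source)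
    (hΦs : ContMDiffOn 𝓘(ℝ, X) I ∞ Φ.symm Φ.target) {g : M → X} {s : Set M} (hs : s ⊆ Φ.source)
    (hg : ContMDiffOn I 𝓘(ℝ, X) ∞ g s) (Z : ∀ x : M, TangentSpace I x)
    (hZ : ∀ x ∈ s, mfderiv I 𝓘(ℝ, X) Φ x (Z x) = g x) :
    ContMDiffOn I I.tangent ∞ (fun x => (⟨x, Z x⟩ : TangentBundle I M)) s := by
  have h1 := contMDiffOn_mfderiv_field Φ.open_target hΦs (φ := Φ) (t := s) (Z := fun x => g x)
    (fun x hx => Φ.map_source (hs hx)) (contMDiffOn_vectorSpace_field (hΦ.mono hs) hg)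
  have hd : Φ.MDifferentiable I 𝓘(ℝ, X) :=
    ⟨hΦ.mdifferentiableOn (by simp), hΦs.mdifferentiableOn (by simp)⟩
  refine h1.congr fun x hx => ?_
  have h2 := congrArg (fun T => T (Z x)) (hd.symm_comp_deriv (hs hx))
  rw [ContinuousLinearMap.comp_apply, hZ x hx] at h2
  -- The points `Φ.symm (Φ x)` and `x` are only propositionally equal. All tangent spaces being the
  -- model space `V`, vectors over the two points are compared there.
  have key : ∀ {y : M} (hy : y = x) (u : TangentSpace I y), (u : V) = (Z x : V) →
      (⟨x, Z x⟩ : TangentBundle I M) = ⟨y, u⟩ := by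
    rintro y rfl u hu
    exact congrArg _ hu.symm
  exact key (Φ.left_inv (hs hx)) _ h2

/-- A smooth local field multiplied by a bump function is a global smooth field. -/
theorem isSmoothVectorField_smul {Z : ∀ x : M, TangentSpace I x} {s : Set M} (hs : IsOpen s)
    (hZ : ContMDiffOn I I.tangent ∞ (fun x => (⟨x, Z x⟩ : TangentBundle I M)) s)
    {χ : M → ℝ} (hχ : ContMDiff I 𝓘(ℝ, ℝ) ∞ χ) (hsupp : tsupport χ ⊆ s) :
    IsSmoothVectorField I (fun x => χ x • Z x) :=
  ContMDiffOn.smul_section_of_tsupport hχ.contMDiffOn hs hsupp hZ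

end LocalFields

/-! ### Submersion charts, local sections, functions constant on fibres -/

section Submersions

variable {V : Type*} [NormedAddCommGroup V] [NormedSpace ℝ V]
  {H : Type*} [TopologicalSpace H] {I : ModelWithCorners ℝ V H}
  {M : Type*} [TopologicalSpace M] [ChartedSpace H M]
  {V' : Type*} [NormedAddCommGroup V'] [NormedSpace ℝ V']
  {H' : Type*} [TopologicalSpace H'] {J : ModelWithCorners ℝ V' H'}
  {N : Type*} [TopologicalSpace N] [ChartedSpace H' N]
  {G : Type*} [NormedAddCommGroup G] [NormedSpace ℝ G]

variable (I J G) in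
/-- Charts `dom` around `x` and `cod` around `F x` in which `F` is the projection
`(a, b) ↦ a`. -/
structure SubmersionChart (F : M → N) (x : M) where
  dom : OpenPartialHomeomorph M (V' × G)
  cod : OpenPartialHomeomorph N V'
  mem : x ∈ dom.source
  mapsTo : MapsTo F dom.source cod.source
  contMDiffOn_dom : ContMDiffOn I 𝓘(ℝ, V' × G) ∞ dom dom.source
  contMDiffOn_dom_symm : ContMDiffOn 𝓘(ℝ, V' × G) I ∞ dom.symm dom.target
  contMDiffOn_cod : ContMDiffOn J 𝓘(ℝ, V') ∞ cod cod.source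
  contMDiffOn_cod_symm : ContMDiffOn 𝓘(ℝ, V') J ∞ cod.symm cod.target
  fst_dom : ∀ y ∈ dom.source, (dom y).1 = cod (F y)

/-- Without boundary the models with corners are homeomorphisms, so composing the adapted charts
with them, and on the source with the linear splitting onto `V' × G`, gives charts with values in
vector spaces. -/
theorem _root_.Manifold.IsSubmersionAtOfComplement.nonempty_submersionChart [I.Boundaryless]
    [J.Boundaryless] {F : M → N} {x : M} (h : IsSubmersionAtOfComplement G I J ∞ F x) :
    Nonempty (SubmersionChart I J G F x) := by
  have hI : ∀ y : V, y ∈ range I := fun y => by simp [I.range_eq_univ]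
  have hJ : ∀ y : V', y ∈ range J := fun y => by simp [J.range_eq_univ]
  refine ⟨{
    dom := (h.domChart.trans I.toHomeomorph.toOpenPartialHomeomorph).trans
      h.equiv.toHomeomorph.toOpenPartialHomeomorph
    cod := h.codChart.trans J.toHomeomorph.toOpenPartialHomeomorph
    mem := by simpa using h.mem_domChart_source
    mapsTo := by
      have : MapsTo F h.domChart.source h.codChart.source := h.source_subset_preimage_source
      simpa using this
    contMDiffOn_dom := ?_
    contMDiffOn_dom_symm := ?_
    contMDiffOn_cod := ?_
    contMDiffOn_cod_symm := ?_
    fst_dom := ?_ }⟩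
  · refine (h.equiv.contDiff.contMDiff.comp_contMDiffOn
      (OpenPartialHomeomorph.contMDiffOn_extend h.domChart_mem_maximalAtlas)).mono ?_
    simp
  · refine (contMDiffOn_extend_symm h.domChart_mem_maximalAtlas).comp
      (h.equiv.symm.contDiff.contMDiff.contMDiffOn) fun y hy => ?_
    refine ⟨_, ?_, I.right_inv (hI _)⟩
    simpa using hy
  · refine (OpenPartialHomeomorph.contMDiffOn_extend h.codChart_mem_maximalAtlas).mono ?_
    simp
  · refine (contMDiffOn_extend_symm h.codChart_mem_maximalAtlas).mono fun y hy => ?_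
    refine ⟨_, ?_, J.right_inv (hJ _)⟩
    simpa using hy
  · intro y hy
    have hy' : y ∈ h.domChart.source := by simpa using hy
    have := h.writtenInCharts ((h.domChart.extend I).map_source (by simpa using hy'))
    rw [Function.comp_apply, Function.comp_apply,
      (h.domChart.extend I).left_inv (by simpa using hy')] at this
    exact this.symm

end Submersions

section Submersions

variable {V : Type*} [NormedAddCommGroup V] [NormedSpace ℝ V]
  {H : Type*} [TopologicalSpace H] {I : ModelWithCorners ℝ V H}
  {M : Type*} [TopologicalSpace M] [ChartedSpace H M] [IsManifold I ∞ M]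
  {V' : Type*} [NormedAddCommGroup V'] [NormedSpace ℝ V']
  {H' : Type*} [TopologicalSpace H'] {J : ModelWithCorners ℝ V' H'}
  {N : Type*} [TopologicalSpace N] [ChartedSpace H' N] [IsManifold J ∞ N]
  {G : Type*} [NormedAddCommGroup G] [NormedSpace ℝ G]
  {F : M → N} {x : M}

namespace SubmersionChart

omit [IsManifold I ∞ M] [IsManifold J ∞ N]

theorem mdifferentiable_dom (C : SubmersionChart I J G F x) :
    C.dom.MDifferentiable I 𝓘(ℝ, V' × G) :=
  ⟨C.contMDiffOn_dom.mdifferentiableOn (by simp), C.contMDiffOn_dom_symm.mdifferentiableOn (by simp)⟩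

theorem mdifferentiable_cod (C : SubmersionChart I J G F x) :
    C.cod.MDifferentiable J 𝓘(ℝ, V') :=
  ⟨C.contMDiffOn_cod.mdifferentiableOn (by simp), C.contMDiffOn_cod_symm.mdifferentiableOn (by simp)⟩

theorem apply_dom_symm (C : SubmersionChart I J G F x) {y : V' × G} (hy : y ∈ C.dom.target) :
    F (C.dom.symm y) = C.cod.symm y.1 := by
  have h := C.fst_dom _ (C.dom.map_target hy)
  rw [C.dom.right_inv hy] at h
  rw [h, C.cod.left_inv (C.mapsTo (C.dom.map_target hy))]

theorem contMDiffOn (C : SubmersionChart I J G F x) : ContMDiffOn I J ∞ F C.dom.source := by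
  have h : ContMDiffOn I J ∞ (fun y => C.cod.symm (C.dom y).1) C.dom.source := by
    refine C.contMDiffOn_cod_symm.comp ((contDiff_fst.contMDiff (𝕜 := ℝ)
      (f := (Prod.fst : V' × G → V'))).comp_contMDiffOn C.contMDiffOn_dom) fun y hy => ?_
    show (C.dom y).1 ∈ C.cod.target
    rw [C.fst_dom y hy]
    exact C.cod.map_source (C.mapsTo hy)
  refine h.congr fun y hy => ?_
  rw [C.fst_dom y hy, C.cod.left_inv (C.mapsTo hy)]

theorem mdifferentiableAt (C : SubmersionChart I J G F x) {y : M} (hy : y ∈ C.dom.source) :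
    MDifferentiableAt I J F y :=
  (C.contMDiffOn.contMDiffAt (C.dom.open_source.mem_nhds hy)).mdifferentiableAt (by simp)

/-- This is the derivative of the identity `fst_dom`. -/
theorem mfderiv_cod_mfderiv (C : SubmersionChart I J G F x) {y : M} (hy : y ∈ C.dom.source)
    (z : TangentSpace I y) :
    mfderiv J 𝓘(ℝ, V') C.cod (F y) (mfderiv I J F y z) =
      (show V' × G from mfderiv I 𝓘(ℝ, V' × G) C.dom y z).1 := by
  have h1 : HasMFDerivAt I 𝓘(ℝ, V') (fun y => C.cod (F y)) y
      ((mfderiv J 𝓘(ℝ, V') C.cod (F y)).comp (mfderiv I J F y)) :=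
    (C.mdifferentiable_cod.mdifferentiableAt (C.mapsTo hy)).hasMFDerivAt.comp y
      (C.mdifferentiableAt hy).hasMFDerivAt
  have h2 : HasMFDerivAt I 𝓘(ℝ, V') (fun y => (C.dom y).1) y
      ((ContinuousLinearMap.fst ℝ V' G).comp (mfderiv I 𝓘(ℝ, V' × G) C.dom y)) :=
    (ContinuousLinearMap.fst ℝ V' G).hasMFDerivAt.comp y
      (C.mdifferentiable_dom.mdifferentiableAt hy).hasMFDerivAt
  have h3 := h2.congr_of_eventuallyEq (Filter.eventuallyEq_of_mem
    (C.dom.open_source.mem_nhds hy) fun y hy => (C.fst_dom y hy).symm)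
  exact congrArg (fun T : TangentSpace I y →L[ℝ] V' => T z) (hasMFDerivAt_unique h1 h3)

/-- The vector field with components `u` in the chart `C.dom`. -/
noncomputable def field (C : SubmersionChart I J G F x) (u : M → V' × G) (y : M) :
    TangentSpace I y :=
  (mfderiv I 𝓘(ℝ, V' × G) C.dom y).inverse (u y)

/-- The vector field with components `u` in the chart `C.cod`. -/
noncomputable def fieldCod (C : SubmersionChart I J G F x) (u : N → V') (p : N) :
    TangentSpace J p :=
  (mfderiv J 𝓘(ℝ, V') C.cod p).inverse (u p)

theorem mfderiv_dom_field (C : SubmersionChart I J G F x) (u : M → V' × G) {y : M}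
    (hy : y ∈ C.dom.source) : mfderiv I 𝓘(ℝ, V' × G) C.dom y (C.field u y) = u y :=
  ContinuousLinearMap.IsInvertible.self_apply_inverse ⟨C.mdifferentiable_dom.mfderiv hy, rfl⟩ _

theorem mfderiv_cod_fieldCod (C : SubmersionChart I J G F x) (u : N → V') {p : N}
    (hp : p ∈ C.cod.source) : mfderiv J 𝓘(ℝ, V') C.cod p (C.fieldCod u p) = u p :=
  ContinuousLinearMap.IsInvertible.self_apply_inverse ⟨C.mdifferentiable_cod.mfderiv hp, rfl⟩ _

theorem mfderiv_field (C : SubmersionChart I J G F x) (u : M → V' × G) (w : N → V') {y : M}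
    (hy : y ∈ C.dom.source) (h : w (F y) = (u y).1) :
    mfderiv I J F y (C.field u y) = C.fieldCod w (F y) := by
  apply C.mdifferentiable_cod.mfderiv_injective (C.mapsTo hy)
  rw [C.mfderiv_cod_mfderiv hy, C.mfderiv_cod_fieldCod w (C.mapsTo hy), h, C.mfderiv_dom_field u hy]

theorem mfderiv_surjective (C : SubmersionChart I J G F x) {y : M} (hy : y ∈ C.dom.source) :
    Function.Surjective (mfderiv I J F y) := by
  intro w
  let w' : V' := mfderiv J 𝓘(ℝ, V') C.cod (F y) w
  refine ⟨C.field (fun _ => (w', 0)) y, ?_⟩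
  rw [C.mfderiv_field _ (fun _ => w') hy rfl]
  apply C.mdifferentiable_cod.mfderiv_injective (C.mapsTo hy)
  exact C.mfderiv_cod_fieldCod _ (C.mapsTo hy)

theorem contMDiffOn_field [IsManifold I ∞ M] (C : SubmersionChart I J G F x) {u : M → V' × G}
    {s : Set M} (hs : s ⊆ C.dom.source) (hu : ContMDiffOn I 𝓘(ℝ, V' × G) ∞ u s) :
    ContMDiffOn I I.tangent ∞ (fun y => (⟨y, C.field u y⟩ : TangentBundle I M)) s :=
  contMDiffOn_field_of_chart C.contMDiffOn_dom C.contMDiffOn_dom_symm hs hu _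
    fun _ hy => C.mfderiv_dom_field u (hs hy)

theorem contMDiffOn_fieldCod [IsManifold J ∞ N] (C : SubmersionChart I J G F x) {u : N → V'}
    {s : Set N} (hs : s ⊆ C.cod.source) (hu : ContMDiffOn J 𝓘(ℝ, V') ∞ u s) :
    ContMDiffOn J J.tangent ∞ (fun y => (⟨y, C.fieldCod u y⟩ : TangentBundle J N)) s :=
  contMDiffOn_field_of_chart C.contMDiffOn_cod C.contMDiffOn_cod_symm hs hu _
    fun _ hy => C.mfderiv_cod_fieldCod u (hs hy)

end SubmersionChart

omit [IsManifold I ∞ M] [IsManifold J ∞ N] in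
/-- A submersion has smooth local sections. -/
theorem SubmersionChart.exists_section (C : SubmersionChart I J G F x) :
    ∃ σ : N → M, σ (F x) = x ∧ ContMDiffAt J I ∞ σ (F x) ∧ ∀ᶠ p in 𝓝 (F x), F (σ p) = p := by
  have hmem : C.dom x ∈ C.dom.target := C.dom.map_source C.mem
  have hx : (C.cod (F x), (C.dom x).2) = C.dom x := by rw [← C.fst_dom x C.mem]
  have hF : F x ∈ C.cod.source := C.mapsTo C.mem
  have hc : ContMDiffAt J 𝓘(ℝ, V' × G) ∞ (fun p => (C.cod p, (C.dom x).2)) (F x) :=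
    (C.contMDiffOn_cod.contMDiffAt (C.cod.open_source.mem_nhds hF)).prodMk_space contMDiffAt_const
  -- The section freezes the fibre coordinate at its value at `x`.
  refine ⟨fun p => C.dom.symm (C.cod p, (C.dom x).2), ?_, ?_, ?_⟩
  · show C.dom.symm (C.cod (F x), (C.dom x).2) = x
    rw [hx, C.dom.left_inv C.mem]
  · refine ContMDiffAt.comp (F x) (I' := 𝓘(ℝ, V' × G)) ?_ hc
    rw [hx]
    exact C.contMDiffOn_dom_symm.contMDiffAt (C.dom.open_target.mem_nhds hmem)
  · have h1 : ∀ᶠ p in 𝓝 (F x), (C.cod p, (C.dom x).2) ∈ C.dom.target :=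
      hc.continuousAt.eventually_mem (by rw [hx]; exact C.dom.open_target.mem_nhds hmem)
    filter_upwards [h1, C.cod.open_source.mem_nhds hF] with p hp hp'
    rw [C.apply_dom_symm hp, C.cod.left_inv hp']

omit [IsManifold I ∞ M] [IsManifold J ∞ N] in
/-- If `df` vanishes on the kernel of the differential of a submersion `F`, then `f` is locally a
function of `F`. -/
theorem SubmersionChart.eventually_eq_of_apply_eq (C : SubmersionChart I J G F x) {f : M → ℝ}
    (hf : MDifferentiable I 𝓘(ℝ, ℝ) f)
    (hker : ∀ y (z : TangentSpace I y), mfderiv I J F y z = 0 → mfderiv I 𝓘(ℝ, ℝ) f y z = 0) :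
    ∀ᶠ y in 𝓝 x, F y = F x → f y = f x := by
  obtain ⟨r, hr, hball⟩ := Metric.isOpen_iff.1 C.dom.open_target _ (C.dom.map_source C.mem)
  filter_upwards [C.dom.open_source.mem_nhds C.mem, (C.dom.continuousAt C.mem).eventually_mem
    (Metric.ball_mem_nhds _ hr)] with y hy hyr hFy
  obtain ⟨hy1, hy2⟩ : (C.dom y).1 = (C.dom x).1 ∧ (C.dom y).2 ∈ Metric.ball (C.dom x).2 r := by
    refine ⟨by rw [C.fst_dom y hy, C.fst_dom x C.mem, hFy], ?_⟩
    rw [← ball_prod_same] at hyr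
    exact hyr.2
  set a := (C.dom x).1
  have hsub : ∀ b ∈ Metric.ball (C.dom x).2 r, (a, b) ∈ C.dom.target := fun b hb =>
    hball (by rw [← ball_prod_same]; exact ⟨Metric.mem_ball_self hr, hb⟩)
  -- The directions `(0, w)` are vertical, so `hker` kills the derivative of `f` along the slice
  -- over `a`. The slice meets the product ball in a convex ball, on which `f` is therefore
  -- constant.
  have hder : ∀ b ∈ Metric.ball (C.dom x).2 r,
      HasFDerivAt (fun b => f (C.dom.symm (a, b))) (0 : G →L[ℝ] ℝ) b := by
    intro b hb
    have h1 : HasMFDerivAt 𝓘(ℝ, G) 𝓘(ℝ, V' × G) (fun b => (a, b)) b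
        (ContinuousLinearMap.inr ℝ V' G) := (hasFDerivAt_prodMk_right a b).hasMFDerivAt
    have h2 : HasMFDerivAt 𝓘(ℝ, G) I (fun b => C.dom.symm (a, b)) b _ :=
      (C.mdifferentiable_dom.mdifferentiableAt_symm (hsub b hb)).hasMFDerivAt.comp b h1
    have h3 : HasMFDerivAt 𝓘(ℝ, G) 𝓘(ℝ, ℝ) (fun b => f (C.dom.symm (a, b))) b _ :=
      (hf _).hasMFDerivAt.comp b h2
    have h4 := h3.hasFDerivAt
    refine h4.congr_fderiv ?_
    ext w
    refine hker _ _ ?_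
    apply C.mdifferentiable_cod.mfderiv_injective (C.mapsTo (C.dom.map_target (hsub b hb)))
    rw [C.mfderiv_cod_mfderiv (C.dom.map_target (hsub b hb)), map_zero]
    have h5 := congrArg (fun T : (V' × G) →L[ℝ] (V' × G) => T (0, w))
      (C.mdifferentiable_dom.comp_symm_deriv (hsub b hb))
    exact congrArg Prod.fst h5
  have hconst := (convex_ball (C.dom x).2 r).is_const_of_fderivWithin_eq_zero (𝕜 := ℝ)
    (f := fun b => f (C.dom.symm (a, b)))
    (fun b hb => (hder b hb).differentiableAt.differentiableWithinAt)
    (fun b hb => by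
      rw [fderivWithin_of_isOpen Metric.isOpen_ball hb, (hder b hb).fderiv])
    hy2 (Metric.mem_ball_self hr)
  have e1 : (a, (C.dom y).2) = C.dom y := by rw [← hy1]
  have e2 : (a, (C.dom x).2) = C.dom x := rfl
  simpa [e1, e2, C.dom.left_inv hy, C.dom.left_inv C.mem] using hconst

omit [IsManifold I ∞ M] [IsManifold J ∞ N] in
/-- Along a surjective submersion with connected fibres, a smooth function whose differential
vanishes on the vertical vectors is projectable. -/
theorem isProjectableFunction_of_mfderiv_eq_zero (hC : ∀ x, Nonempty (SubmersionChart I J G F x))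
    (hsurj : Function.Surjective F) (hconn : ∀ p, IsPreconnected (F ⁻¹' {p})) {f : M → ℝ}
    (hf : ContMDiff I 𝓘(ℝ, ℝ) ∞ f)
    (hker : ∀ y (z : TangentSpace I y), mfderiv I J F y z = 0 → mfderiv I 𝓘(ℝ, ℝ) f y z = 0) :
    IsProjectableFunction J F f := by
  have hfib : ∀ x y, F x = F y → f x = f y := by
    intro x y hxy
    -- Equality of the values of `f` is an equivalence relation that holds locally on the fibre,
    -- hence on the whole preconnected fibre.
    refine (hconn (F y)).induction₂ (fun x y => f x = f y) (fun x hx => ?_) (fun _ _ _ _ _ _ h h' => h.trans h')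
      (fun _ _ _ _ h => h.symm) hxy rfl
    obtain ⟨C⟩ := hC x
    filter_upwards [nhdsWithin_le_nhds (C.eventually_eq_of_apply_eq
      (hf.mdifferentiable (by simp)) hker), self_mem_nhdsWithin] with z hz hz'
    exact (hz (hz'.trans hx.symm)).symm
  -- The preimages are chosen arbitrarily, without any continuity; smoothness holds because near
  -- each point the result agrees with `f ∘ σ` for a smooth local section `σ`.
  refine ⟨fun p => f (Function.surjInv hsurj p), fun p => ?_, ?_⟩
  · obtain ⟨x, rfl⟩ := hsurj p
    obtain ⟨C⟩ := hC x
    obtain ⟨σ, hσ, hσs, hσF⟩ := C.exists_section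
    refine ContMDiffAt.congr_of_eventuallyEq (f := f ∘ σ) ((hf _).comp _ hσs) ?_
    filter_upwards [hσF] with p hp
    exact hfib _ _ (by rw [hp, Function.surjInv_eq hsurj])
  · ext y
    exact hfib _ _ (by rw [Function.surjInv_eq hsurj])

end Submersions

/-! ### Lifting vector fields and replacing kernel fields by projectable ones -/

section ProjectableFields

variable {V : Type*} [NormedAddCommGroup V] [NormedSpace ℝ V]
  {H : Type*} [TopologicalSpace H] {I : ModelWithCorners ℝ V H}
  {M : Type*} [TopologicalSpace M] [ChartedSpace H M] [IsManifold I ∞ M]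
  {V' : Type*} [NormedAddCommGroup V'] [NormedSpace ℝ V']
  {H' : Type*} [TopologicalSpace H'] {J : ModelWithCorners ℝ V' H'}
  {N : Type*} [TopologicalSpace N] [ChartedSpace H' N] [IsManifold J ∞ N]
  {G : Type*} [NormedAddCommGroup G] [NormedSpace ℝ G]
  {F : M → N}

theorem exists_bump [FiniteDimensional ℝ V] [T2Space M] {s : Set M} {x : M} (hs : s ∈ 𝓝 x) :
    ∃ χ : M → ℝ, ContMDiff I 𝓘(ℝ, ℝ) ∞ χ ∧ χ =ᶠ[𝓝 x] 1 ∧ tsupport χ ⊆ s := by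
  obtain ⟨f, hf, hfs⟩ := (SmoothBumpFunction.nhds_basis_tsupport (I := I) x).mem_iff.1 hs
  exact ⟨f, f.contMDiff, f.eventuallyEq_one, hfs⟩

/-- A smooth vector field on the base of a submersion has a smooth lift which takes a prescribed
smooth value near a closed set. -/
theorem exists_lift [FiniteDimensional ℝ V] [T2Space M] [SigmaCompactSpace M]
    (hC : ∀ x, Nonempty (SubmersionChart I J G F x))
    {Y : ∀ p : N, TangentSpace J p} (hY : IsSmoothVectorField J Y) {s t : Set M} (ht : IsClosed t)
    (hs : IsOpen s) (hts : t ⊆ s) {w : ∀ x : M, TangentSpace I x}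
    (hw : ContMDiffOn I I.tangent ∞ (fun x => (⟨x, w x⟩ : TangentBundle I M)) s)
    (hwY : ∀ x ∈ s, mfderiv I J F x (w x) = Y (F x)) :
    ∃ W : ∀ x : M, TangentSpace I x, IsSmoothVectorField I W ∧
      (∀ x, mfderiv I J F x (W x) = Y (F x)) ∧ ∀ x ∈ t, W x = w x := by
  -- Lifting `Y` and agreeing with `w` on `t` are affine conditions on the value at each point, so a
  -- partition of unity glues local solutions.
  let T : ∀ x : M, Set (TangentSpace I x) :=
    fun x => {z | mfderiv I J F x z = Y (F x) ∧ (x ∈ t → z = w x)}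
  have hconv : ∀ x, Convex ℝ (T x) := by
    intro x z hz z' hz' a b _ _ hab
    refine ⟨?_, fun hx => ?_⟩
    · rw [map_add, map_smul, map_smul, hz.1, hz'.1, ← add_smul, hab, one_smul]
    · rw [hz.2 hx, hz'.2 hx, ← add_smul, hab, one_smul]
  suffices h : ∀ x₀ : M, ∃ U ∈ 𝓝 x₀, ∃ z : ∀ x : M, TangentSpace I x,
      ContMDiffOn I I.tangent ∞ (fun x => (⟨x, z x⟩ : TangentBundle I M)) U ∧
        ∀ y ∈ U, z y ∈ T y by
    obtain ⟨W, hW⟩ := exists_contMDiffSection_forall_mem_convex_of_local (n := (⊤ : ℕ∞))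
      (F_fiber := V) I (TangentSpace I : M → Type _) T hconv h
    exact ⟨fun x => W x, W.contMDiff, fun x => (hW x).1, fun x => (hW x).2⟩
  intro x
  by_cases hx : x ∈ t
  · exact ⟨s, hs.mem_nhds (hts hx), w, hw, fun y hy => ⟨hwY y hy, fun _ => rfl⟩⟩
  · obtain ⟨C⟩ := hC x
    let u : N → V' := fun p => mfderiv J 𝓘(ℝ, V') C.cod p (Y p)
    have hu : ContMDiffOn J 𝓘(ℝ, V') ∞ u C.cod.source :=
      contMDiffOn_mfderiv_apply C.cod.open_source C.contMDiffOn_cod hY.contMDiffOn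
    -- Away from `t` any lift will do; the one with zero fibre component in the chart is used.
    refine ⟨C.dom.source ∩ tᶜ, (C.dom.open_source.inter ht.isOpen_compl).mem_nhds ⟨C.mem, hx⟩,
      C.field fun y => (u (F y), 0), ?_, fun y hy => ⟨?_, fun h => absurd h hy.2⟩⟩
    · refine C.contMDiffOn_field inter_subset_left ?_
      exact ((hu.comp C.contMDiffOn C.mapsTo).prodMk_space contMDiffOn_const).mono
        inter_subset_left
    · rw [C.mfderiv_field _ u hy.1 rfl]
      apply C.mdifferentiable_cod.mfderiv_injective (C.mapsTo hy.1)
      exact C.mfderiv_cod_fieldCod u (C.mapsTo hy.1)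

/-- The smooth vector fields on `M` whose image under the differential of `F` lies in the subspaces
of the tangent spaces of `N` cut out by the linear forms `l`. -/
def liftedDistribution (I : ModelWithCorners ℝ V H) (J : ModelWithCorners ℝ V' H')
    [IsManifold I ∞ M] (F : M → N) {ι : Type*}
    (l : ι → ∀ p : N, TangentSpace J p →L[ℝ] ℝ) : Set (∀ x : M, TangentSpace I x) :=
  {Z | IsSmoothVectorField I Z ∧ ∀ i x, l i (F x) (mfderiv I J F x (Z x)) = 0}

/-- Every field of the lifted distribution is congruent to a projectable one, modulo combinations of
fields of the distribution with coefficients vanishing at a given point. -/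
theorem exists_projectable_add_sum [FiniteDimensional ℝ V] [FiniteDimensional ℝ V']
    [FiniteDimensional ℝ G] [T2Space M] [SigmaCompactSpace M] [T2Space N]
    (hC : ∀ x, Nonempty (SubmersionChart I J G F x)) {ι : Type*}
    {l : ι → ∀ p : N, TangentSpace J p →L[ℝ] ℝ} {Z : ∀ x : M, TangentSpace I x}
    (hZ : Z ∈ liftedDistribution I J F l) (x₀ : M) :
    ∃ W ∈ liftedDistribution I J F l, IsProjectableVectorField I J F W ∧
      ∃ (n : ℕ) (h : Fin n → ∀ x : M, TangentSpace I x) (β : Fin n → M → ℝ) (U : Set M),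
        IsOpen U ∧ x₀ ∈ U ∧ (∀ j, h j ∈ liftedDistribution I J F l) ∧
        (∀ j, ContMDiffOn I 𝓘(ℝ, ℝ) ∞ (β j) U) ∧ (∀ j, β j x₀ = 0) ∧
        ∀ x ∈ U, Z x = W x + ∑ j, β j x • h j x := by
  obtain ⟨C⟩ := hC x₀
  -- the components of `Z` in the chart
  let ζ : M → V' × G := fun x => mfderiv I 𝓘(ℝ, V' × G) C.dom x (Z x)
  have hζ : ContMDiffOn I 𝓘(ℝ, V' × G) ∞ ζ C.dom.source :=
    contMDiffOn_mfderiv_apply C.dom.open_source C.contMDiffOn_dom hZ.1.contMDiffOn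
  have hf₀ : ContDiffOn ℝ ∞ (fun y => (ζ (C.dom.symm y)).1) C.dom.target :=
    contMDiffOn_iff_contDiffOn.1 ((contDiff_fst.contMDiff (𝕜 := ℝ)
      (f := (Prod.fst : V' × G → V'))).comp_contMDiffOn
        (hζ.comp C.contMDiffOn_dom_symm fun y hy => C.dom.map_target hy))
  -- `exists_hadamard` needs a globally smooth function. The extension `f` agrees with the base
  -- component of `Z` on a product ball, and the linear equations are available only there.
  obtain ⟨r, hr, hball, f, hf, hff₀⟩ :=
    exists_contDiff_eqOn_ball C.dom.open_target hf₀ (C.dom.map_source C.mem)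
  rw [← Prod.mk.eta (p := C.dom x₀), ← ball_prod_same] at hball hff₀
  set b₀ := (C.dom x₀).2 with hb₀
  set a₀ := (C.dom x₀).1 with ha₀
  have hb₀r : b₀ ∈ Metric.ball b₀ r := Metric.mem_ball_self hr
  obtain ⟨h, hh, hsum, hker⟩ := exists_hadamard (Module.finBasis ℝ G) hf b₀
  set e := Module.finBasis ℝ G
  let B : Set (V' × G) := Metric.ball a₀ r ×ˢ Metric.ball b₀ r
  have hBo : IsOpen B := Metric.isOpen_ball.prod Metric.isOpen_ball
  let O : Set M := C.dom.source ∩ C.dom ⁻¹' B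
  have hO : IsOpen O := C.dom.isOpen_inter_preimage hBo
  have hx₀O : x₀ ∈ O := ⟨C.mem, Metric.mem_ball_self hr, Metric.mem_ball_self hr⟩
  -- the linear forms, transported to the chart
  have hlf : ∀ i (p : N), p ∈ C.cod.source → C.cod p ∈ Metric.ball a₀ r →
      ∀ b ∈ Metric.ball b₀ r,
        l i p ((mfderiv J 𝓘(ℝ, V') C.cod p).inverse (f (C.cod p, b))) = 0 := by
    intro i p hp hpr b hb
    have hy : (C.cod p, b) ∈ C.dom.target := hball ⟨hpr, hb⟩
    have hF : F (C.dom.symm (C.cod p, b)) = p := by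
      rw [C.apply_dom_symm hy, C.cod.left_inv hp]
    rw [hff₀ ⟨hpr, hb⟩]
    show l i p ((mfderiv J 𝓘(ℝ, V') C.cod p).inverse (ζ (C.dom.symm (C.cod p, b))).1) = 0
    have hx := C.dom.map_target hy
    have h1 := hZ.2 i (C.dom.symm (C.cod p, b))
    have h2 := C.mfderiv_cod_mfderiv hx (Z (C.dom.symm (C.cod p, b)))
    -- Replacing `p` by `F x` makes the tangent spaces at the two points literally the same.
    generalize C.dom.symm (C.cod p, b) = x at *
    subst hF
    rw [← h1]
    congr 1
    apply C.mdifferentiable_cod.mfderiv_injective hp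
    rw [h2]
    exact ContinuousLinearMap.IsInvertible.self_apply_inverse
      ⟨C.mdifferentiable_cod.mfderiv hp, rfl⟩ _
  -- For fixed `p` the form and the inverse chart differential do not involve `b`, so their
  -- composition is one linear form that vanishes on all `f (C.cod p, b)`; the remainders inherit
  -- this.
  have hlh : ∀ i (p : N), p ∈ C.cod.source → C.cod p ∈ Metric.ball a₀ r →
      ∀ b ∈ Metric.ball b₀ r, ∀ j,
        l i p ((mfderiv J 𝓘(ℝ, V') C.cod p).inverse (h j (C.cod p, b))) = 0 :=
    fun i p hp hpr => hker ((l i p).comp (mfderiv J 𝓘(ℝ, V') C.cod p).inverse) _ _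
      Metric.isOpen_ball (convex_ball _ _) hb₀r (hlf i p hp hpr)
  have hdomO : ∀ x ∈ O, C.cod (F x) ∈ Metric.ball a₀ r := fun x hx => by
    rw [← C.fst_dom x hx.1]; exact hx.2.1
  -- the projected field
  obtain ⟨χ, hχ, hχ1, hχs⟩ := exists_bump (I := J) (s := C.cod.source ∩ C.cod ⁻¹' Metric.ball a₀ r)
    (x := F x₀) ((C.cod.isOpen_inter_preimage Metric.isOpen_ball).mem_nhds
      ⟨C.mapsTo C.mem, hdomO x₀ hx₀O⟩)
  let u : N → V' := fun p => f (C.cod p, b₀)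
  have hu : ContMDiffOn J 𝓘(ℝ, V') ∞ u C.cod.source :=
    hf.contMDiff.comp_contMDiffOn (C.contMDiffOn_cod.prodMk_space contMDiffOn_const)
  have hY : IsSmoothVectorField J (fun p => χ p • C.fieldCod u p) :=
    isSmoothVectorField_smul C.cod.open_source (C.contMDiffOn_fieldCod subset_rfl hu) hχ
      (hχs.trans inter_subset_left)
  have hlY : ∀ i p, l i p (χ p • C.fieldCod u p) = 0 := by
    intro i p
    by_cases hp : p ∈ tsupport χ
    · rw [map_smul, SubmersionChart.fieldCod, hlf i p (hχs hp).1 (hχs hp).2 b₀ hb₀r, smul_zero]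
    · rw [image_eq_zero_of_notMem_tsupport hp, zero_smul, map_zero]
  -- the prescribed local lift
  let w : M → V' × G := fun x => (u (F x), (ζ x).2)
  have hw : ContMDiffOn I 𝓘(ℝ, V' × G) ∞ w C.dom.source :=
    (hu.comp C.contMDiffOn C.mapsTo).prodMk_space ((contDiff_snd.contMDiff (𝕜 := ℝ)
      (f := (Prod.snd : V' × G → G))).comp_contMDiffOn hζ)
  -- Over `t₁` the cut-off is 1, so the local lift covers the cut-off field itself, as `exists_lift`
  -- requires.
  obtain ⟨t₁, ht₁, ht₁o, hxt₁⟩ := eventually_nhds_iff.1 hχ1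
  let S : Set M := C.dom.source ∩ F ⁻¹' t₁
  have hS : IsOpen S := C.contMDiffOn.continuousOn.isOpen_inter_preimage C.dom.open_source ht₁o
  have : LocallyCompactSpace M := Manifold.locallyCompact_of_finiteDimensional I
  obtain ⟨t, htx, htc, htS⟩ := exists_mem_nhds_isClosed_subset (hS.mem_nhds ⟨C.mem, hxt₁⟩)
  obtain ⟨W, hWs, hWY, hWt⟩ := exists_lift hC hY htc hS htS
    (C.contMDiffOn_field (u := w) inter_subset_left (hw.mono inter_subset_left)) (fun x hx => by
      rw [C.mfderiv_field w u hx.1 rfl, ht₁ _ hx.2]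
      exact (one_smul ℝ _).symm)
  -- the remainder terms
  obtain ⟨ρ, hρ, hρ1, hρs⟩ := exists_bump (I := I) (hO.mem_nhds hx₀O)
  -- The lift `w` keeps the fibre component of `Z`, so the remainder has only a base component.
  let H : Fin (Module.finrank ℝ G) → M → V' × G := fun j x => (h j (C.dom x), 0)
  have hH : ∀ j, ContMDiffOn I 𝓘(ℝ, V' × G) ∞ (H j) C.dom.source := fun j =>
    ((hh j).contMDiff.comp_contMDiffOn C.contMDiffOn_dom).prodMk_space contMDiffOn_const
  refine ⟨W, ⟨hWs, fun i x => by rw [hWY, hlY]⟩, ⟨_, hY, hWY⟩, Module.finrank ℝ G,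
    fun j x => ρ x • C.field (H j) x, fun j x => e.repr ((C.dom x).2 - b₀) j,
    O ∩ interior t ∩ interior {x | ρ x = 1}, (hO.inter isOpen_interior).inter isOpen_interior,
    ⟨⟨hx₀O, mem_interior_iff_mem_nhds.2 htx⟩, mem_interior_iff_mem_nhds.2 hρ1⟩,
    fun j => ⟨isSmoothVectorField_smul hO
      (C.contMDiffOn_field inter_subset_left ((hH j).mono inter_subset_left)) hρ hρs,
      fun i x => ?_⟩, fun j => ?_, fun j => ?_, fun x hx => ?_⟩
  · by_cases hx : x ∈ tsupport ρ
    · have hxO := hρs hx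
      have hab : (C.cod (F x), (C.dom x).2) = C.dom x := by rw [← C.fst_dom x hxO.1]
      have key := hlh i (F x) (C.mapsTo hxO.1) (hdomO x hxO) (C.dom x).2 hxO.2.2 j
      rw [hab] at key
      rw [map_smul, map_smul, C.mfderiv_field (H j) (fun _ => h j (C.dom x)) hxO.1 rfl,
        SubmersionChart.fieldCod, key, smul_zero]
    · show l i (F x) (mfderiv I J F x (ρ x • C.field (H j) x)) = 0
      rw [image_eq_zero_of_notMem_tsupport hx, zero_smul, map_zero, map_zero]
  · have h1 : ContDiff ℝ ∞ fun y : V' × G => e.repr (y.2 - b₀) j := by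
      have : ContDiff ℝ ∞ (LinearMap.toContinuousLinearMap (e.coord j)) :=
        ContinuousLinearMap.contDiff _
      exact this.comp (contDiff_snd.sub contDiff_const)
    exact (h1.contMDiff.comp_contMDiffOn C.contMDiffOn_dom).mono fun x hx => hx.1.1.1
  · simp [hb₀]
  · have hxs : x ∈ C.dom.source := hx.1.1.1
    have hρx : ρ x = 1 := interior_subset (s := {x | ρ x = 1}) hx.2
    rw [hWt x (interior_subset hx.1.2)]
    apply C.mdifferentiable_dom.mfderiv_injective hxs
    have hab : (C.cod (F x), (C.dom x).2) = C.dom x := by rw [← C.fst_dom x hxs]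
    simp_rw [hρx, one_smul]
    rw [map_add, map_sum, C.mfderiv_dom_field w hxs]
    simp_rw [map_smul, C.mfderiv_dom_field _ hxs]
    have hfx : (ζ x).1 = f (C.dom x) := by
      rw [hff₀ hx.1.1.2]
      show (ζ x).1 = (ζ (C.dom.symm (C.dom x))).1
      rw [C.dom.left_inv hxs]
    have h2 := hsum (C.cod (F x)) (C.dom x).2
    rw [hab] at h2
    show ζ x = w x + ∑ j, e.repr ((C.dom x).2 - b₀) j • H j x
    ext1
    · simp only [Prod.fst_add, Prod.fst_sum, Prod.smul_fst, H, w, u]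
      rw [hfx, ← h2]
      abel
    · simp [Prod.snd_sum, H, w]

end ProjectableFields

/-! ### Local generators: the Nakayama argument -/

section Generators

theorem contDiff_matrix_det (r : ℕ) :
    ContDiff ℝ ∞ fun A : Fin r → Fin r → ℝ => (Matrix.of A).det := by
  simp only [Matrix.det_apply, Matrix.of_apply]
  fun_prop

/-- An adjugate entry is the determinant after one row is replaced by a basis vector. -/
theorem contDiff_matrix_adjugate (r : ℕ) (i l : Fin r) :
    ContDiff ℝ ∞ fun A : Fin r → Fin r → ℝ => (Matrix.of A).adjugate i l := by
  have h : ∀ A : Fin r → Fin r → ℝ, (Matrix.of A).adjugate i l =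
      (Matrix.of fun a b => if a = l then (Pi.single i 1 : Fin r → ℝ) b else A a b).det := by
    intro A
    rw [Matrix.adjugate_apply]
    congr 1
    ext a b
    exact Matrix.updateRow_apply
  simp only [h]
  refine (contDiff_matrix_det r).comp
    (g := fun A : Fin r → Fin r → ℝ => (Matrix.of A).det)
    (f := fun (A : Fin r → Fin r → ℝ) a b => if a = l then (Pi.single i 1 : Fin r → ℝ) b else A a b)
    (contDiff_pi.2 fun a => contDiff_pi.2 fun b => ?_)
  split_ifs <;> fun_prop

variable {V : Type*} [NormedAddCommGroup V] [NormedSpace ℝ V]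
  {H : Type*} [TopologicalSpace H] {I : ModelWithCorners ℝ V H}
  {M : Type*} [TopologicalSpace M] [ChartedSpace H M]

/-- A matrix of smooth functions is invertible with smooth inverse near a point where it is the
identity. -/
theorem exists_smooth_inverse_matrix {r : ℕ} {A : M → Fin r → Fin r → ℝ} {U : Set M} (hU : IsOpen U)
    (hA : ∀ i l, ContMDiffOn I 𝓘(ℝ, ℝ) ∞ (fun x => A x i l) U) {v : M} (hv : v ∈ U)
    (hAv : Matrix.of (A v) = 1) :
    ∃ U' ⊆ U, IsOpen U' ∧ v ∈ U' ∧ ∃ B : M → Matrix (Fin r) (Fin r) ℝ,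
      (∀ i l, ContMDiffOn I 𝓘(ℝ, ℝ) ∞ (fun x => B x i l) U') ∧
      ∀ x ∈ U', B x * Matrix.of (A x) = 1 := by
  have hA' : ContMDiffOn I 𝓘(ℝ, Fin r → Fin r → ℝ) ∞ A U :=
    contMDiffOn_pi_space.2 fun i => contMDiffOn_pi_space.2 fun l => hA i l
  have hdet : ContMDiffOn I 𝓘(ℝ, ℝ) ∞ (fun x => (Matrix.of (A x)).det) U :=
    (contDiff_matrix_det r).contMDiff.comp_contMDiffOn hA'
  refine ⟨U ∩ (fun x => (Matrix.of (A x)).det) ⁻¹' {0}ᶜ, inter_subset_left,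
    hdet.continuousOn.isOpen_inter_preimage hU isOpen_compl_singleton, ⟨hv, by simp [hAv]⟩,
    fun x => (Matrix.of (A x))⁻¹, fun i l => ?_, fun x hx => ?_⟩
  · simp only [Matrix.inv_def, Matrix.smul_apply, Ring.inverse_eq_inv', smul_eq_mul]
    refine ContMDiffOn.mul (fun x hx => ?_)
      (((contDiff_matrix_adjugate r i l).contMDiff.comp_contMDiffOn hA').mono inter_subset_left)
    exact ((contDiffAt_inv ℝ hx.2).contMDiffAt).comp_contMDiffWithinAt x
      ((hdet x hx.1).mono inter_subset_left)
  · exact Matrix.nonsing_inv_mul _ (isUnit_iff_ne_zero.2 hx.2)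

variable [IsManifold I ∞ M]
  {V' : Type*} [NormedAddCommGroup V'] [NormedSpace ℝ V']
  {H' : Type*} [TopologicalSpace H'] {J : ModelWithCorners ℝ V' H'}
  {N : Type*} [TopologicalSpace N] [ChartedSpace H' N] [IsManifold J ∞ N]
  {G : Type*} [NormedAddCommGroup G] [NormedSpace ℝ G]
  {F : M → N}

/-- Local generators of the lifted distribution can be replaced by as many projectable ones. -/
theorem exists_projectable_generators [FiniteDimensional ℝ V] [FiniteDimensional ℝ V']
    [FiniteDimensional ℝ G] [T2Space M] [SigmaCompactSpace M] [T2Space N]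
    (hC : ∀ x, Nonempty (SubmersionChart I J G F x)) {ι : Type*}
    {l : ι → ∀ p : N, TangentSpace J p →L[ℝ] ℝ} {r : ℕ} {Z : Fin r → ∀ x : M, TangentSpace I x}
    (hZ : ∀ i, Z i ∈ liftedDistribution I J F l) {U : Set M} (hU : IsOpen U)
    (hgen : ∀ X ∈ liftedDistribution I J F l, ∃ c : Fin r → M → ℝ,
      (∀ i, ContMDiffOn I 𝓘(ℝ, ℝ) ∞ (c i) U) ∧ ∀ x ∈ U, X x = ∑ i, c i x • Z i x)
    {v : M} (hv : v ∈ U) :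
    ∃ U' ⊆ U, IsOpen U' ∧ v ∈ U' ∧ ∃ W : Fin r → ∀ x : M, TangentSpace I x,
      (∀ i, W i ∈ liftedDistribution I J F l) ∧ (∀ i, IsProjectableVectorField I J F (W i)) ∧
      ∀ X ∈ liftedDistribution I J F l, ∃ c : Fin r → M → ℝ,
        (∀ i, ContMDiffOn I 𝓘(ℝ, ℝ) ∞ (c i) U') ∧ ∀ x ∈ U', X x = ∑ i, c i x • W i x := by
  choose W hW hWp n h β O hO hvO hh hβ hβv hsum using
    fun i => exists_projectable_add_sum hC (hZ i) v
  choose c hc hcsum using fun i j => hgen (h i j) (hh i j)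
  -- Expanding the remainders `h i j` in the generators turns `W i = Z i - ∑ j, β i j • h i j` into
  -- `W = A Z`. All `β i j` vanish at `v`, so `A v` is the identity.
  let A : M → Fin r → Fin r → ℝ := fun x i m => (1 : Matrix (Fin r) (Fin r) ℝ) i m -
    ∑ j, β i j x * c i j m x
  have hA : ∀ i m, ContMDiffOn I 𝓘(ℝ, ℝ) ∞ (fun x => A x i m) (U ∩ ⋂ i, O i) := by
    intro i m
    refine contMDiffOn_const.sub (contMDiffOn_finsetSum fun j _ => ?_)
    exact ((hβ i j).mono (inter_subset_right.trans (iInter_subset _ i))).mul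
      ((hc i j m).mono inter_subset_left)
  have hAv : Matrix.of (A v) = 1 := by
    ext i m
    simp [A, hβv]
  have hWA : ∀ i, ∀ x ∈ U ∩ ⋂ i, O i, W i x = ∑ m, A x i m • Z m x := by
    intro i x hx
    have h1 := hsum i x (mem_iInter.1 hx.2 i)
    have h2 : ∑ m, (1 : Matrix (Fin r) (Fin r) ℝ) i m • Z m x = Z i x := by
      simp [Matrix.one_apply]
    have h3 : ∑ m, (∑ j, β i j x * c i j m x) • Z m x = ∑ j, β i j x • h i j x := by
      simp_rw [hcsum i _ x hx.1, Finset.smul_sum, Finset.sum_smul, smul_smul]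
      exact Finset.sum_comm
    simp only [A, sub_smul, Finset.sum_sub_distrib]
    rw [h2, h3, h1, add_sub_cancel_right]
  obtain ⟨U', hU', hU'o, hvU', B, hB, hBA⟩ := exists_smooth_inverse_matrix
    (hU.inter (isOpen_iInter_of_finite hO)) hA ⟨hv, mem_iInter.2 hvO⟩ hAv
  refine ⟨U', hU'.trans inter_subset_left, hU'o, hvU', W, hW, hWp, fun X hX => ?_⟩
  obtain ⟨d, hd, hdsum⟩ := hgen X hX
  refine ⟨fun i x => ∑ m, d m x * B x m i, fun i => contMDiffOn_finsetSum fun m _ =>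
    ((hd m).mono (hU'.trans inter_subset_left)).mul (hB m i), fun x hx => ?_⟩
  have h1 : ∀ m, ∑ i, B x m i • W i x = Z m x := by
    intro m
    simp_rw [hWA _ x (hU' hx), Finset.smul_sum, smul_smul]
    rw [Finset.sum_comm]
    simp_rw [← Finset.sum_smul]
    have h2 : ∀ m', ∑ i, B x m i * A x i m' = (1 : Matrix (Fin r) (Fin r) ℝ) m m' := fun m' => by
      rw [← hBA x hx, Matrix.mul_apply]; rfl
    simp [h2, Matrix.one_apply]
  rw [hdsum x (hU' hx).1]
  simp_rw [← h1, Finset.smul_sum, Finset.sum_smul, smul_smul]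
  exact Finset.sum_comm

end Generators

/-! ### Separation and countability of total spaces, for bump functions and partitions of unity -/

section TotalSpaces

variable {B F : Type*} [TopologicalSpace B] [TopologicalSpace F] (E : B → Type*)
  [TopologicalSpace (Bundle.TotalSpace F E)] [∀ b, TopologicalSpace (E b)] [FiberBundle F E]

-- Two points over the same base point are separated inside one trivialization, other points by
-- their projections.
variable (F) in
theorem t2Space_totalSpace [T2Space B] [T2Space F] : T2Space (Bundle.TotalSpace F E) := by
  refine ⟨fun x y hxy => ?_⟩
  by_cases h : x.proj = y.proj
  · let e := trivializationAt F E x.proj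
    have hx : x ∈ e.source := FiberBundle.mem_trivializationAt_proj_source
    have hy : y ∈ e.source := by
      rw [e.mem_source, ← h]
      exact FiberBundle.mem_baseSet_trivializationAt' _
    obtain ⟨u, w, hu, hw, hxu, hyw, huw⟩ := t2_separation fun h => hxy (e.injOn hx hy h)
    exact ⟨e.source ∩ e ⁻¹' u, e.source ∩ e ⁻¹' w,
      e.toOpenPartialHomeomorph.isOpen_inter_preimage hu,
      e.toOpenPartialHomeomorph.isOpen_inter_preimage hw, ⟨hx, hxu⟩, ⟨hy, hyw⟩,
      (huw.preimage e).mono inter_subset_right inter_subset_right⟩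
  · obtain ⟨u, w, hu, hw, hxu, hyw, huw⟩ := t2_separation h
    exact ⟨_, _, hu.preimage (FiberBundle.continuous_proj F E),
      hw.preimage (FiberBundle.continuous_proj F E), hxu, hyw, huw.preimage _⟩

variable (F) in
theorem secondCountableTopology_totalSpace [SecondCountableTopology B]
    [SecondCountableTopology F] : SecondCountableTopology (Bundle.TotalSpace F E) := by
  obtain ⟨s, hs, hcover⟩ := TopologicalSpace.countable_cover_nhds fun b : B =>
    (trivializationAt F E b).open_baseSet.mem_nhds (FiberBundle.mem_baseSet_trivializationAt' b)
  have := hs.to_subtype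
  have : ∀ b : s, SecondCountableTopology (trivializationAt F E (b : B)).source := fun b =>
    (trivializationAt F E (b : B)).toOpenPartialHomeomorph.secondCountableTopology_source
  refine TopologicalSpace.secondCountableTopology_of_countable_cover
    (fun b : s => (trivializationAt F E (b : B)).open_source) (eq_univ_of_forall fun x => ?_)
  have hx : x.proj ∈ ⋃ b ∈ s, (trivializationAt F E b).baseSet := by rw [hcover]; trivial
  obtain ⟨b, hb, hxb⟩ := mem_iUnion₂.1 hx
  exact mem_iUnion.2 ⟨⟨b, hb⟩, (Bundle.Trivialization.mem_source _).2 hxb⟩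

end TotalSpaces

section Bundles

variable {E : Type*} [NormedAddCommGroup E] [NormedSpace ℝ E] [FiniteDimensional ℝ E]
variable (k : ℕ) (Q : Type*) [TopologicalSpace Q] [ChartedSpace E Q] [IsManifold 𝓘(ℝ, E) ∞ Q]

theorem t2Space_kTangentBundle [T2Space Q] : T2Space (KTangentBundle (E := E) k Q) :=
  t2Space_totalSpace _ _

theorem t2Space_kCotangentBundle [T2Space Q] : T2Space (KCotangentBundle (E := E) k Q) :=
  t2Space_totalSpace _ _

theorem sigmaCompactSpace_kTangentBundle [SecondCountableTopology Q] :
    SigmaCompactSpace (KTangentBundle (E := E) k Q) := by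
  have : SecondCountableTopology (KTangentBundle (E := E) k Q) :=
    secondCountableTopology_totalSpace _ _
  have : LocallyCompactSpace (KTangentBundle (E := E) k Q) :=
    Manifold.locallyCompact_of_finiteDimensional (modelT E k)
  infer_instance

end Bundles

/-! ### Bundle charts of the `k`-tangent and `k`-cotangent bundles -/

section Charts

variable {E : Type*} [NormedAddCommGroup E] [NormedSpace ℝ E] [FiniteDimensional ℝ E]
variable {k : ℕ} {Q : Type*} [TopologicalSpace Q] [ChartedSpace E Q] [IsManifold 𝓘(ℝ, E) ∞ Q]

theorem extChartAt_kTangentBundle_symm (v : KTangentBundle (E := E) k Q) (y : E × (Fin k → E)) :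
    (extChartAt (modelT E k) v).symm y = ⟨(extChartAt 𝓘(ℝ, E) v.proj).symm y.1, fun α =>
      tangentCoordChange 𝓘(ℝ, E) v.proj ((extChartAt 𝓘(ℝ, E) v.proj).symm y.1)
        ((extChartAt 𝓘(ℝ, E) v.proj).symm y.1) (y.2 α)⟩ := by
  rw [FiberBundle.extChartAt]
  rfl

theorem extChartAt_kCotangentBundle (p w : KCotangentBundle (E := E) k Q) :
    extChartAt (modelT' E k) p w = (extChartAt 𝓘(ℝ, E) p.proj w.proj,
      fun α => (show E →L[ℝ] ℝ from w.snd α).comp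
        (tangentCoordChange 𝓘(ℝ, E) p.proj w.proj w.proj)) := by
  rw [FiberBundle.extChartAt]
  rfl

theorem extChartAt_kTangentBundle_target (v : KTangentBundle (E := E) k Q) :
    (extChartAt (modelT E k) v).target = (extChartAt 𝓘(ℝ, E) v.proj).target ×ˢ univ := by
  rw [FiberBundle.extChartAt_target]
  congr 1
  refine inter_eq_left.2 fun y hy => ?_
  have := (extChartAt 𝓘(ℝ, E) v.proj).map_target hy
  rwa [extChartAt_source] at this

-- The tangent space at a point is identified with `E` through the preferred chart there, so the
-- derivative of the inverse of another chart is a transition function of the tangent bundle.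
omit [FiniteDimensional ℝ E] in
theorem mfderiv_extChartAt_symm (q : Q) {y : E} (hy : y ∈ (extChartAt 𝓘(ℝ, E) q).target) :
    mfderiv 𝓘(ℝ, E) 𝓘(ℝ, E) (extChartAt 𝓘(ℝ, E) q).symm y =
      tangentCoordChange 𝓘(ℝ, E) q ((extChartAt 𝓘(ℝ, E) q).symm y)
        ((extChartAt 𝓘(ℝ, E) q).symm y) := by
  have hs := (extChartAt 𝓘(ℝ, E) q).map_target hy
  rw [extChartAt_source] at hs
  rw [tangentCoordChange, ← TangentBundle.symmL_trivializationAt_eq_core hs,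
    TangentBundle.symmL_trivializationAt hs, (extChartAt 𝓘(ℝ, E) q).right_inv hy,
    ModelWithCorners.range_eq_univ, mfderivWithin_univ]

theorem contMDiff_fiber_inclusion (q : Q) :
    ContMDiff 𝓘(ℝ, Fin k → E) (modelT E k) ∞
      (fun w : Fin k → E => (⟨q, w⟩ : KTangentBundle (E := E) k Q)) := by
  intro w
  refine Bundle.contMDiffAt_totalSpace.2 ⟨contMDiffAt_const, ?_⟩
  exact (ContinuousLinearMap.contDiff (copies k E (tangentCoordChange 𝓘(ℝ, E) q q q))).contMDiff w

end Charts

/-! ### Exterior derivative of a 1-form on a vector space -/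

section OneForms

variable {V : Type*} [NormedAddCommGroup V] [NormedSpace ℝ V]

theorem extDeriv_ofSubsingleton {θ : V → V →L[ℝ] ℝ} {c : V} (hθ : DifferentiableAt ℝ θ c) (u w : V) :
    extDeriv (fun y => ContinuousAlternatingMap.ofSubsingleton ℝ V ℝ (0 : Fin 1) (θ y)) c ![u, w] =
      fderiv ℝ θ c u w - fderiv ℝ θ c w u := by
  have h : (fun y => ContinuousAlternatingMap.ofSubsingleton ℝ V ℝ (0 : Fin 1) (θ y)) =
      fun y => (ContinuousAlternatingMap.ofSubsingletonLIE (𝕜 := ℝ) (E := V) (F := ℝ) (0 : Fin 1)) (θ y) := rfl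
  have h' := ((ContinuousAlternatingMap.ofSubsingletonLIE (𝕜 := ℝ) (E := V) (F := ℝ)
    (0 : Fin 1)).toContinuousLinearEquiv.hasFDerivAt.comp c hθ.hasFDerivAt).fderiv
  rw [extDeriv, h]
  refine (congrArg (fun T => ContinuousAlternatingMap.alternatizeUncurryFin T ![u, w]) h').trans ?_
  rw [ContinuousAlternatingMap.alternatizeUncurryFin_apply, Fin.sum_univ_two]
  simp [sub_eq_add_neg]
  rfl

end OneForms

/-! ### The Legendre map and the Cartan 1-forms in bundle charts -/

section Lagrangian

variable {E : Type*} [NormedAddCommGroup E] [NormedSpace ℝ E] [FiniteDimensional ℝ E]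
variable {k : ℕ} {Q : Type*} [TopologicalSpace Q] [ChartedSpace E Q] [IsManifold 𝓘(ℝ, E) ∞ Q]
variable {L : KTangentBundle (E := E) k Q → ℝ}

theorem hasFDerivAt_fiber (hL : ContMDiff (modelT E k) 𝓘(ℝ, ℝ) ∞ L)
    (v : KTangentBundle (E := E) k Q) :
    HasFDerivAt (fun w : Fin k → E => L ⟨v.proj, w⟩) ((differential L v).comp (fiberDeriv v))
      v.snd := by
  have h1 : HasMFDerivAt (modelT E k) 𝓘(ℝ, ℝ) L v (differential L v) :=
    (hL.mdifferentiable (by simp) v).hasMFDerivAt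
  have h2 : HasMFDerivAt 𝓘(ℝ, Fin k → E) (modelT E k)
      (fun w : Fin k → E => (⟨v.proj, w⟩ : KTangentBundle (E := E) k Q)) v.snd (fiberDeriv v) :=
    ((contMDiff_fiber_inclusion v.proj).mdifferentiable (by simp) _).hasMFDerivAt
  exact (HasMFDerivAt.comp (g := L) (show Fin k → E from v.snd) h1 h2).hasFDerivAt

/-- Links the two descriptions of the momenta: the vector-space derivative along the fibre used in
`legendre`, and the manifold differential used in the Cartan forms and the energy. -/
theorem differential_verticalLift (hL : ContMDiff (modelT E k) 𝓘(ℝ, ℝ) ∞ L) (α : Fin k)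
    (v : KTangentBundle (E := E) k Q) (u : E) :
    differential L v (verticalLift α v u) = (show E →L[ℝ] ℝ from (legendre L v).snd α) u := by
  show _ = fderiv ℝ (fun w : Fin k → E => L ⟨v.proj, w⟩) v.snd
    (ContinuousLinearMap.single ℝ (fun _ : Fin k => E) α u)
  rw [(hasFDerivAt_fiber hL v).fderiv]
  rfl

theorem energy_eq (hL : ContMDiff (modelT E k) 𝓘(ℝ, ℝ) ∞ L) (v : KTangentBundle (E := E) k Q) :
    energy L v = ∑ α, (show E →L[ℝ] ℝ from (legendre L v).snd α) (v.snd α) - L v := by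
  rw [energy, liouville, map_sum]
  simp_rw [← differential_verticalLift hL]

theorem fderiv_fiber_apply (v : KTangentBundle (E := E) k Q) (u : Fin k → E) :
    fderiv ℝ (fun w : Fin k → E => L ⟨v.proj, w⟩) v.snd u =
      ∑ α, (show E →L[ℝ] ℝ from (legendre L v).snd α) (u α) := by
  have hu : u = ∑ α, ContinuousLinearMap.single ℝ (fun _ : Fin k => E) α (u α) := by
    ext β
    simp [Finset.sum_apply, Pi.single_apply]
  conv_lhs => rw [hu, map_sum]
  rfl

/-- The Legendre map in the bundle charts over the chart of `Q` at the base point of `v`. -/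
noncomputable def legendreChart (L : KTangentBundle (E := E) k Q → ℝ) (v : KTangentBundle (E := E) k Q)
    (y : E × (Fin k → E)) : E × (Fin k → (E →L[ℝ] ℝ)) :=
  extChartAt (modelT' E k) (legendre L v) (legendre L ((extChartAt (modelT E k) v).symm y))

theorem legendreChart_fst (v : KTangentBundle (E := E) k Q) {y : E × (Fin k → E)}
    (hy : y ∈ (extChartAt (modelT E k) v).target) : (legendreChart L v y).1 = y.1 := by
  rw [extChartAt_kTangentBundle_target] at hy
  rw [legendreChart, extChartAt_kCotangentBundle, extChartAt_kTangentBundle_symm]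
  exact (extChartAt 𝓘(ℝ, E) v.proj).right_inv hy.1

theorem legendreChart_snd (v : KTangentBundle (E := E) k Q) (y : E × (Fin k → E)) (α : Fin k) :
    (legendreChart L v y).2 α =
      (show E →L[ℝ] ℝ from (legendre L ((extChartAt (modelT E k) v).symm y)).snd α).comp
        (tangentCoordChange 𝓘(ℝ, E) v.proj ((extChartAt (modelT E k) v).symm y).proj
          ((extChartAt (modelT E k) v).symm y).proj) := by
  rw [legendreChart, extChartAt_kCotangentBundle]
  rfl

theorem mem_extChartAt_kCotangentBundle_source {p w : KCotangentBundle (E := E) k Q}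
    (h : w.proj ∈ (chartAt E p.proj).source) : w ∈ (extChartAt (modelT' E k) p).source := by
  rw [FiberBundle.extChartAt]
  exact ⟨h, by rwa [← extChartAt_source 𝓘(ℝ, E)] at h, mem_univ _⟩

theorem proj_extChartAt_symm_mem (v : KTangentBundle (E := E) k Q) {y : E × (Fin k → E)}
    (hy : y ∈ (extChartAt (modelT E k) v).target) :
    ((extChartAt (modelT E k) v).symm y).proj ∈ (chartAt E v.proj).source := by
  rw [extChartAt_kTangentBundle_target] at hy
  rw [extChartAt_kTangentBundle_symm, ← extChartAt_source 𝓘(ℝ, E)]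
  exact (extChartAt 𝓘(ℝ, E) v.proj).map_target hy.1

theorem contDiffOn_legendreChart (hFL : ContMDiff (modelT E k) (modelT' E k) ∞ (legendre L))
    (v : KTangentBundle (E := E) k Q) :
    ContDiffOn ℝ ∞ (legendreChart L v) (extChartAt (modelT E k) v).target := by
  rw [← contMDiffOn_iff_contDiffOn]
  refine (contMDiffOn_extChartAt (I := modelT' E k) (x := legendre L v)).comp
    (hFL.comp_contMDiffOn (contMDiffOn_extChartAt_symm v)) fun y hy => ?_
  rw [← extChartAt_source (modelT' E k)]
  exact mem_extChartAt_kCotangentBundle_source (proj_extChartAt_symm_mem v hy)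

theorem extChartAt_target_mem_nhds_self (v : KTangentBundle (E := E) k Q) :
    (extChartAt (modelT E k) v).target ∈ 𝓝 (extChartAt (modelT E k) v v) :=
  extChartAt_target_mem_nhds v

theorem hasFDerivAt_legendreChart (hFL : ContMDiff (modelT E k) (modelT' E k) ∞ (legendre L))
    (v : KTangentBundle (E := E) k Q) :
    HasFDerivAt (legendreChart L v) (fderiv ℝ (legendreChart L v) (extChartAt (modelT E k) v v))
      (extChartAt (modelT E k) v v) :=
  (((contDiffOn_legendreChart hFL v).contDiffAt
    (extChartAt_target_mem_nhds_self v)).differentiableAt (by simp)).hasFDerivAt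

theorem fderiv_legendreChart (hFL : ContMDiff (modelT E k) (modelT' E k) ∞ (legendre L))
    (v : KTangentBundle (E := E) k Q) (z : TangentSpace (modelT E k) v) :
    fderiv ℝ (legendreChart L v) (extChartAt (modelT E k) v v)
        (mfderiv (modelT E k) 𝓘(ℝ, E × (Fin k → E)) (extChartAt (modelT E k) v) v z) =
      mfderiv (modelT' E k) 𝓘(ℝ, E × (Fin k → (E →L[ℝ] ℝ)))
        (extChartAt (modelT' E k) (legendre L v)) (legendre L v)
        (mfderiv (modelT E k) (modelT' E k) (legendre L) v z) := by
  have h1 : HasMFDerivAt (modelT E k) 𝓘(ℝ, E × (Fin k → (E →L[ℝ] ℝ)))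
      (legendreChart L v ∘ extChartAt (modelT E k) v) v _ :=
    (hasFDerivAt_legendreChart hFL v).hasMFDerivAt.comp v
      (mdifferentiableAt_extChartAt (mem_chart_source _ v)).hasMFDerivAt
  have h2 : HasMFDerivAt (modelT E k) 𝓘(ℝ, E × (Fin k → (E →L[ℝ] ℝ)))
      (extChartAt (modelT' E k) (legendre L v) ∘ legendre L) v _ :=
    (mdifferentiableAt_extChartAt (mem_chart_source _ _)).hasMFDerivAt.comp v
      (hFL.mdifferentiable (by simp) v).hasMFDerivAt
  have h3 := h2.congr_of_eventuallyEq (f₁ := legendreChart L v ∘ extChartAt (modelT E k) v) (by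
    filter_upwards [extChartAt_source_mem_nhds (I := modelT E k) v] with w hw
    simp only [Function.comp, legendreChart]
    rw [(extChartAt (modelT E k) v).left_inv hw])
  exact congrArg (fun T => T z) (hasMFDerivAt_unique h1 h3)

/-- In bundle coordinates the Cartan form is `p_α dq`: `J^α` sees only the projection of a vector to
`Q`, and `dL` of a vertical lift is the momentum. The transition function met on projecting is the
one by which the bundle chart transports the momentum. -/
theorem cartanOneForm_chart (hL : ContMDiff (modelT E k) 𝓘(ℝ, ℝ) ∞ L) (α : Fin k)
    (v : KTangentBundle (E := E) k Q) {y : E × (Fin k → E)}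
    (hy : y ∈ (extChartAt (modelT E k) v).target) :
    (cartanOneForm L α ((extChartAt (modelT E k) v).symm y)).comp
        (mfderiv 𝓘(ℝ, E × (Fin k → E)) (modelT E k) (extChartAt (modelT E k) v).symm y) =
      ((legendreChart L v y).2 α).comp (ContinuousLinearMap.fst ℝ E (Fin k → E)) := by
  have hy1 : y.1 ∈ (extChartAt 𝓘(ℝ, E) v.proj).target := by
    rw [extChartAt_kTangentBundle_target] at hy
    exact hy.1
  have h1 : HasMFDerivAt 𝓘(ℝ, E × (Fin k → E)) 𝓘(ℝ, E)
      (fun y => ((extChartAt (modelT E k) v).symm y).proj) y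
      ((mfderiv (modelT E k) 𝓘(ℝ, E) (fun w : KTangentBundle (E := E) k Q => w.proj)
        ((extChartAt (modelT E k) v).symm y)).comp
        (mfderiv 𝓘(ℝ, E × (Fin k → E)) (modelT E k) (extChartAt (modelT E k) v).symm y)) :=
    ((Bundle.contMDiff_proj _).mdifferentiable (n := ∞) (by simp) _).hasMFDerivAt.comp y
      (((contMDiffOn_extChartAt_symm (n := ∞) v).contMDiffAt
        ((isOpen_extChartAt_target v).mem_nhds hy)).mdifferentiableAt (by simp)).hasMFDerivAt
  have h2 : HasMFDerivAt 𝓘(ℝ, E × (Fin k → E)) 𝓘(ℝ, E)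
      (fun y : E × (Fin k → E) => (extChartAt 𝓘(ℝ, E) v.proj).symm y.1) y
      ((mfderiv 𝓘(ℝ, E) 𝓘(ℝ, E) (extChartAt 𝓘(ℝ, E) v.proj).symm y.1).comp
        (ContinuousLinearMap.fst ℝ E (Fin k → E))) :=
    HasMFDerivAt.comp (I' := 𝓘(ℝ, E)) y
      (((contMDiffOn_extChartAt_symm (n := ∞) v.proj).contMDiffAt
        ((isOpen_extChartAt_target v.proj).mem_nhds hy1)).mdifferentiableAt (by simp)).hasMFDerivAt
      (ContinuousLinearMap.fst ℝ E (Fin k → E)).hasMFDerivAt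
  have h3 : (fun y => ((extChartAt (modelT E k) v).symm y).proj) =
      fun y : E × (Fin k → E) => (extChartAt 𝓘(ℝ, E) v.proj).symm y.1 := by
    ext y
    rw [extChartAt_kTangentBundle_symm]
  rw [h3] at h1
  have h4 := hasMFDerivAt_unique h1 h2
  rw [mfderiv_extChartAt_symm _ hy1] at h4
  rw [legendreChart_snd]
  ext u
  refine (differential_verticalLift hL α _ _).trans ?_
  refine congrArg (show E →L[ℝ] ℝ from
    (legendre L ((extChartAt (modelT E k) v).symm y)).snd α) ?_
  refine (congrArg (fun T => T u) h4).trans ?_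
  rw [extChartAt_kTangentBundle_symm]
  rfl

end Lagrangian

/-! ### Cartan 2-forms as pull-backs; the energy along the kernel of the Legendre differential -/

section Lagrangian

variable {E : Type*} [NormedAddCommGroup E] [NormedSpace ℝ E] [FiniteDimensional ℝ E]
variable {k : ℕ} {Q : Type*} [TopologicalSpace Q] [ChartedSpace E Q] [IsManifold 𝓘(ℝ, E) ∞ Q]
variable {L : KTangentBundle (E := E) k Q → ℝ}

/-- The differential at `p` of the bundle chart of `(T¹ₖ)*Q` at `p`. -/
noncomputable def chartDifferential (p : KCotangentBundle (E := E) k Q) :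
    TangentSpace (modelT' E k) p →L[ℝ] E × (Fin k → (E →L[ℝ] ℝ)) :=
  mfderiv (modelT' E k) 𝓘(ℝ, E × (Fin k → (E →L[ℝ] ℝ))) (extChartAt (modelT' E k) p) p

/-- The canonical 2-form `ω^α` of `(T¹ₖ)*Q` with one argument inserted, computed in the bundle chart
at `p`. -/
noncomputable def canonicalForm (α : Fin k) (p : KCotangentBundle (E := E) k Q)
    (y : TangentSpace (modelT' E k) p) : TangentSpace (modelT' E k) p →L[ℝ] ℝ :=
  (((chartDifferential p y).2 α).comp (ContinuousLinearMap.fst ℝ E (Fin k → (E →L[ℝ] ℝ))) -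
    (ContinuousLinearMap.apply ℝ ℝ (chartDifferential p y).1).comp
      ((ContinuousLinearMap.proj (R := ℝ) (φ := fun _ : Fin k => E →L[ℝ] ℝ) α).comp
        (ContinuousLinearMap.snd ℝ E (Fin k → (E →L[ℝ] ℝ))))).comp (chartDifferential p)

theorem canonicalForm_apply (α : Fin k) (p : KCotangentBundle (E := E) k Q)
    (x y : TangentSpace (modelT' E k) p) :
    canonicalForm α p y x = (chartDifferential p y).2 α (chartDifferential p x).1 -
      (chartDifferential p x).2 α (chartDifferential p y).1 := rfl

theorem hasFDerivAt_legendreChart_snd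
    (hFL : ContMDiff (modelT E k) (modelT' E k) ∞ (legendre L))
    (v : KTangentBundle (E := E) k Q) (α : Fin k) :
    HasFDerivAt (fun y => (legendreChart L v y).2 α)
      (((ContinuousLinearMap.proj (R := ℝ) (φ := fun _ : Fin k => E →L[ℝ] ℝ) α).comp
        (ContinuousLinearMap.snd ℝ E (Fin k → (E →L[ℝ] ℝ)))).comp
          (fderiv ℝ (legendreChart L v) (extChartAt (modelT E k) v v)))
      (extChartAt (modelT E k) v v) :=
  ((ContinuousLinearMap.proj (R := ℝ) (φ := fun _ : Fin k => E →L[ℝ] ℝ) α).comp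
    (ContinuousLinearMap.snd ℝ E (Fin k → (E →L[ℝ] ℝ)))).hasFDerivAt.comp _
      (hasFDerivAt_legendreChart hFL v)

/-- The Legendre map covers the identity of `Q`. -/
theorem fderiv_legendreChart_fst
    (hFL : ContMDiff (modelT E k) (modelT' E k) ∞ (legendre L))
    (v : KTangentBundle (E := E) k Q) (u : E × (Fin k → E)) :
    (fderiv ℝ (legendreChart L v) (extChartAt (modelT E k) v v) u).1 = u.1 := by
  have h2 : HasFDerivAt (fun y => (legendreChart L v y).1)
      (ContinuousLinearMap.fst ℝ E (Fin k → E)) (extChartAt (modelT E k) v v) :=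
    (ContinuousLinearMap.fst ℝ E (Fin k → E)).hasFDerivAt.congr_of_eventuallyEq (by
      filter_upwards [extChartAt_target_mem_nhds_self v] with y hy
      exact legendreChart_fst v hy)
  exact congrArg (fun T => T u) ((hasFDerivAt_legendreChart hFL v).fst.unique h2)

/-- The Cartan 2-forms are the pull-backs of the canonical ones by the Legendre map. -/
theorem cartanTwoForm_eq (hL : ContMDiff (modelT E k) 𝓘(ℝ, ℝ) ∞ L)
    (hFL : ContMDiff (modelT E k) (modelT' E k) ∞ (legendre L)) (α : Fin k)
    (v : KTangentBundle (E := E) k Q) (z w : TangentSpace (modelT E k) v) :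
    cartanTwoForm L α v z w =
      canonicalForm α (legendre L v) (mfderiv (modelT E k) (modelT' E k) (legendre L) v w)
        (mfderiv (modelT E k) (modelT' E k) (legendre L) v z) := by
  let c := extChartAt (modelT E k) v v
  let P' : E × (Fin k → E) →L[ℝ] E × (Fin k → (E →L[ℝ] ℝ)) := fderiv ℝ (legendreChart L v) c
  -- Composition with the first projection, written as a continuous linear map so that `θ`, the
  -- coordinate form `p_α dq`, is differentiated by the chain rule.
  let R : (E →L[ℝ] ℝ) →L[ℝ] (E × (Fin k → E) →L[ℝ] ℝ) :=
    (ContinuousLinearMap.compL ℝ (E × (Fin k → E)) E ℝ).flip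
      (ContinuousLinearMap.fst ℝ E (Fin k → E))
  let θ : E × (Fin k → E) → (E × (Fin k → E) →L[ℝ] ℝ) := fun y => R ((legendreChart L v y).2 α)
  have hθ : HasFDerivAt θ (R.comp (((ContinuousLinearMap.proj (R := ℝ)
      (φ := fun _ : Fin k => E →L[ℝ] ℝ) α).comp
        (ContinuousLinearMap.snd ℝ E (Fin k → (E →L[ℝ] ℝ)))).comp P')) c :=
    R.hasFDerivAt.comp c (hasFDerivAt_legendreChart_snd hFL v α)
  have heq : (fun y => ContinuousAlternatingMap.ofSubsingleton ℝ (E × (Fin k → E)) ℝ (0 : Fin 1)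
      ((cartanOneForm L α ((extChartAt (modelT E k) v).symm y)).comp
        (mfderiv 𝓘(ℝ, E × (Fin k → E)) (modelT E k) (extChartAt (modelT E k) v).symm y))) =ᶠ[𝓝 c]
      fun y => ContinuousAlternatingMap.ofSubsingleton ℝ (E × (Fin k → E)) ℝ (0 : Fin 1) (θ y) := by
    filter_upwards [extChartAt_target_mem_nhds_self v] with y hy
    exact congrArg _ (cartanOneForm_chart hL α v hy)
  have hfst : ∀ u, (P' u).1 = u.1 := fderiv_legendreChart_fst hFL v
  let Z : E × (Fin k → E) :=
    mfderiv (modelT E k) 𝓘(ℝ, E × (Fin k → E)) (extChartAt (modelT E k) v) v z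
  let W : E × (Fin k → E) :=
    mfderiv (modelT E k) 𝓘(ℝ, E × (Fin k → E)) (extChartAt (modelT E k) v) v w
  have h1 : cartanTwoForm L α v z w = -(extDeriv (fun y =>
      ContinuousAlternatingMap.ofSubsingleton ℝ (E × (Fin k → E)) ℝ (0 : Fin 1) (θ y)) c ![Z, W]) :=
    congrArg (fun η : (E × (Fin k → E)) [⋀^Fin 2]→L[ℝ] ℝ => -(η ![Z, W])) heq.extDeriv_eq
  have hz : chartDifferential (legendre L v)
      (mfderiv (modelT E k) (modelT' E k) (legendre L) v z) = P' Z :=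
    (fderiv_legendreChart hFL v z).symm
  have hw : chartDifferential (legendre L v)
      (mfderiv (modelT E k) (modelT' E k) (legendre L) v w) = P' W :=
    (fderiv_legendreChart hFL v w).symm
  rw [h1, extDeriv_ofSubsingleton hθ.differentiableAt, hθ.fderiv, canonicalForm_apply,
    hz, hw]
  show -(((P' Z).2 α) W.1 - ((P' W).2 α) Z.1) = ((P' W).2 α) (P' Z).1 - ((P' Z).2 α) (P' W).1
  rw [hfst, hfst]
  ring

/-- The energy in the bundle chart at `v`. -/
noncomputable def energyChart (L : KTangentBundle (E := E) k Q → ℝ)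
    (v : KTangentBundle (E := E) k Q) (y : E × (Fin k → E)) : ℝ :=
  ∑ α, (legendreChart L v y).2 α (y.2 α) - L ((extChartAt (modelT E k) v).symm y)

theorem energy_extChartAt_symm (hL : ContMDiff (modelT E k) 𝓘(ℝ, ℝ) ∞ L)
    (v : KTangentBundle (E := E) k Q) (y : E × (Fin k → E)) :
    energy L ((extChartAt (modelT E k) v).symm y) = energyChart L v y := by
  rw [energy_eq hL, energyChart]
  congr 1

theorem energy_eventuallyEq (hL : ContMDiff (modelT E k) 𝓘(ℝ, ℝ) ∞ L)
    (v : KTangentBundle (E := E) k Q) :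
    energy L =ᶠ[𝓝 v] energyChart L v ∘ extChartAt (modelT E k) v := by
  filter_upwards [extChartAt_source_mem_nhds (I := modelT E k) v] with w hw
  rw [Function.comp_apply, ← energy_extChartAt_symm hL, (extChartAt (modelT E k) v).left_inv hw]

theorem contDiffAt_comp_extChartAt_symm (hL : ContMDiff (modelT E k) 𝓘(ℝ, ℝ) ∞ L)
    (v : KTangentBundle (E := E) k Q) :
    ContDiffAt ℝ ∞ (fun y => L ((extChartAt (modelT E k) v).symm y))
      (extChartAt (modelT E k) v v) := by
  rw [← contMDiffAt_iff_contDiffAt]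
  exact (hL _).comp _ ((contMDiffOn_extChartAt_symm (n := ∞) v).contMDiffAt
    (extChartAt_target_mem_nhds_self v))

theorem contDiffAt_energyChart (hL : ContMDiff (modelT E k) 𝓘(ℝ, ℝ) ∞ L)
    (hFL : ContMDiff (modelT E k) (modelT' E k) ∞ (legendre L))
    (v : KTangentBundle (E := E) k Q) :
    ContDiffAt ℝ ∞ (energyChart L v) (extChartAt (modelT E k) v v) := by
  refine (ContDiffAt.sum fun α _ => ?_).sub (contDiffAt_comp_extChartAt_symm hL v)
  have h := (contDiffOn_legendreChart hFL v).contDiffAt (extChartAt_target_mem_nhds_self v)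
  exact ((contDiff_apply ℝ (E →L[ℝ] ℝ) α).contDiffAt.comp _ h.snd).clm_apply (by fun_prop)

theorem contMDiff_energy (hL : ContMDiff (modelT E k) 𝓘(ℝ, ℝ) ∞ L)
    (hFL : ContMDiff (modelT E k) (modelT' E k) ∞ (legendre L)) :
    ContMDiff (modelT E k) 𝓘(ℝ, ℝ) ∞ (energy L) := fun v =>
  ((contDiffAt_energyChart hL hFL v).contMDiffAt.comp v contMDiffAt_extChartAt).congr_of_eventuallyEq
    (energy_eventuallyEq hL v)

/-- The differential of the energy vanishes on the kernel of the differential of the Legendre map. -/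
theorem differential_energy_eq_zero (hL : ContMDiff (modelT E k) 𝓘(ℝ, ℝ) ∞ L)
    (hFL : ContMDiff (modelT E k) (modelT' E k) ∞ (legendre L))
    (v : KTangentBundle (E := E) k Q) (z : TangentSpace (modelT E k) v)
    (hz : mfderiv (modelT E k) (modelT' E k) (legendre L) v z = 0) :
    mfderiv (modelT E k) 𝓘(ℝ, ℝ) (energy L) v z = 0 := by
  let c : E × (Fin k → E) := extChartAt (modelT E k) v v
  let u : E × (Fin k → E) :=
    mfderiv (modelT E k) 𝓘(ℝ, E × (Fin k → E)) (extChartAt (modelT E k) v) v z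
  let P' : E × (Fin k → E) →L[ℝ] E × (Fin k → (E →L[ℝ] ℝ)) := fderiv ℝ (legendreChart L v) c
  have hPu : P' u = 0 := by
    have h := fderiv_legendreChart hFL v z
    rw [hz] at h
    exact h.trans (mfderiv (modelT' E k) 𝓘(ℝ, E × (Fin k → (E →L[ℝ] ℝ)))
      (extChartAt (modelT' E k) (legendre L v)) (legendre L v)).map_zero
  have hu1 : u.1 = 0 := by
    rw [← fderiv_legendreChart_fst hFL v u]
    exact congrArg Prod.fst hPu
  have hℓ : HasFDerivAt (fun y => L ((extChartAt (modelT E k) v).symm y))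
      (fderiv ℝ (fun y => L ((extChartAt (modelT E k) v).symm y)) c) c :=
    ((contDiffAt_comp_extChartAt_symm hL v).differentiableAt (by simp)).hasFDerivAt
  -- the derivative of `L` along the fibre
  have hℓu : fderiv ℝ (fun y => L ((extChartAt (modelT E k) v).symm y)) c u =
      ∑ α, (legendreChart L v c).2 α (u.2 α) := by
    have h1 : HasFDerivAt (fun b => L ((extChartAt (modelT E k) v).symm (c.1, b)))
        ((fderiv ℝ (fun y => L ((extChartAt (modelT E k) v).symm y)) c).comp
          (ContinuousLinearMap.inr ℝ E (Fin k → E))) c.2 :=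
      HasFDerivAt.comp c.2 hℓ (hasFDerivAt_prodMk_right c.1 c.2)
    let q := (extChartAt 𝓘(ℝ, E) v.proj).symm c.1
    let T : (Fin k → E) →L[ℝ] (Fin k → E) := copies k E (tangentCoordChange 𝓘(ℝ, E) v.proj q q)
    have h2 : (fun b => L ((extChartAt (modelT E k) v).symm (c.1, b))) = fun b => L ⟨q, T b⟩ := by
      ext b
      rw [extChartAt_kTangentBundle_symm]
      rfl
    have h3 : HasFDerivAt (fun b => L ⟨q, T b⟩)
        ((fderiv ℝ (fun w : Fin k → E => L ⟨q, w⟩) (T c.2)).comp T) c.2 :=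
      HasFDerivAt.comp (g := fun w : Fin k → E => L ⟨q, w⟩) c.2
        (hasFDerivAt_fiber hL ⟨q, T c.2⟩).differentiableAt.hasFDerivAt T.hasFDerivAt
    rw [h2] at h1
    have hu : u = (0, u.2) := Prod.ext hu1 rfl
    rw [hu]
    refine (congrArg (fun S => S u.2) (h1.unique h3)).trans ?_
    refine (fderiv_fiber_apply (L := L) ⟨q, T c.2⟩ (T u.2)).trans ?_
    refine Finset.sum_congr rfl fun α _ => ?_
    rw [legendreChart_snd, extChartAt_kTangentBundle_symm]
    rfl
  have he : HasFDerivAt (energyChart L v) (fderiv ℝ (energyChart L v) c) c :=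
    ((contDiffAt_energyChart hL hFL v).differentiableAt (by simp)).hasFDerivAt
  have h1 : HasMFDerivAt (modelT E k) 𝓘(ℝ, ℝ) (energyChart L v ∘ extChartAt (modelT E k) v) v _ :=
    he.hasMFDerivAt.comp v (mdifferentiableAt_extChartAt (mem_chart_source _ v)).hasMFDerivAt
  rw [(h1.congr_of_eventuallyEq (energy_eventuallyEq hL v)).mfderiv]
  show fderiv ℝ (energyChart L v) c u = 0
  -- Product rule for `p_α(v_α)`. On `u` the term with the derivative of `p_α` vanishes by `hPu`,
  -- and the terms `p_α(u_α)` add up to the derivative of `L` by `hℓu`, so they cancel against it.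
  have hα : ∀ α, HasFDerivAt (fun y : E × (Fin k → E) => (legendreChart L v y).2 α (y.2 α))
      (((legendreChart L v c).2 α).comp ((ContinuousLinearMap.proj (R := ℝ)
        (φ := fun _ : Fin k => E) α).comp (ContinuousLinearMap.snd ℝ E (Fin k → E))) +
        ((((ContinuousLinearMap.proj (R := ℝ) (φ := fun _ : Fin k => E →L[ℝ] ℝ) α).comp
          (ContinuousLinearMap.snd ℝ E (Fin k → (E →L[ℝ] ℝ)))).comp P').flip (c.2 α))) c := fun α =>
    (hasFDerivAt_legendreChart_snd hFL v α).clm_apply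
      (ContinuousLinearMap.hasFDerivAt ((ContinuousLinearMap.proj (R := ℝ)
        (φ := fun _ : Fin k => E) α).comp (ContinuousLinearMap.snd ℝ E (Fin k → E))))
  have hsum := (HasFDerivAt.fun_sum (u := Finset.univ) fun α _ => hα α).sub hℓ
  refine (congrArg (fun S => S u) hsum.fderiv).trans ?_
  rw [sub_apply, hℓu, sub_eq_zero]
  simp [hPu]

end Lagrangian

/-! ### Almost-regular Lagrangians: kernel, energy and constraints on `P₀` -/

section AlmostRegular

universe u

variable {E : Type u} [NormedAddCommGroup E] [NormedSpace ℝ E] [FiniteDimensional ℝ E]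
variable {k : ℕ} {Q : Type*} [TopologicalSpace Q] [ChartedSpace E Q] [IsManifold 𝓘(ℝ, E) ∞ Q]
variable {L : KTangentBundle (E := E) k Q → ℝ}
  {E₀ : Type*} [NormedAddCommGroup E₀] [NormedSpace ℝ E₀]
  [ChartedSpace E₀ (range (legendre L))]

namespace IsAlmostRegular

theorem contMDiff_legendre₀ (hL : IsAlmostRegular L E₀) :
    ContMDiff (modelT E k) 𝓘(ℝ, E₀) ∞ (legendre₀ L) :=
  hL.isSubmersion.contMDiff

theorem contMDiff_legendre (hL : IsAlmostRegular L E₀) :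
    ContMDiff (modelT E k) (modelT' E k) ∞ (legendre L) :=
  hL.isSmoothEmbedding.contMDiff.comp hL.contMDiff_legendre₀

theorem mfderiv_legendre (hL : IsAlmostRegular L E₀) (v : KTangentBundle (E := E) k Q)
    (z : TangentSpace (modelT E k) v) :
    mfderiv (modelT E k) (modelT' E k) (legendre L) v z =
      mfderiv 𝓘(ℝ, E₀) (modelT' E k)
        (Subtype.val : range (legendre L) → KCotangentBundle (E := E) k Q) (legendre₀ L v)
        (mfderiv (modelT E k) 𝓘(ℝ, E₀) (legendre₀ L) v z) :=
  congrArg (fun T => T z) (mfderiv_comp v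
    (hL.isSmoothEmbedding.contMDiff.mdifferentiable (by simp) (legendre₀ L v))
    (hL.contMDiff_legendre₀.mdifferentiable (by simp) v))

/-- At any point the submersion splits the model space as `E₀ × G`, so `G` is finite-dimensional as
soon as there is a point. -/
theorem exists_submersionChart (hL : IsAlmostRegular L E₀) :
    ∃ (G : Type u) (_ : NormedAddCommGroup G) (_ : NormedSpace ℝ G),
      (∀ v, Nonempty (SubmersionChart (modelT E k) 𝓘(ℝ, E₀) G (legendre₀ L) v)) ∧
      (Nonempty (KTangentBundle (E := E) k Q) → FiniteDimensional ℝ G) := by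
  obtain ⟨G, _, _, h⟩ := hL.isSubmersion
  refine ⟨G, _, _, fun v => (h v).nonempty_submersionChart, fun ⟨v⟩ => ?_⟩
  exact Module.Finite.of_surjective
    ((LinearMap.snd ℝ E₀ G).comp ((h v).equiv.toLinearEquiv : (E × (Fin k → E)) →ₗ[ℝ] E₀ × G))
    (Prod.snd_surjective.comp (h v).equiv.surjective)

variable (L E₀) in
/-- The linear forms which cut out the intersection of the kernels of the canonical 2-forms
restricted to the image `P₀` of the Legendre map. -/
noncomputable def restrictedForm (i : Fin k × E₀) (p : range (legendre L)) :
    TangentSpace 𝓘(ℝ, E₀) p →L[ℝ] ℝ :=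
  (canonicalForm i.1 (p : KCotangentBundle (E := E) k Q)
    (mfderiv 𝓘(ℝ, E₀) (modelT' E k)
      (Subtype.val : range (legendre L) → KCotangentBundle (E := E) k Q) p i.2)).comp
    (mfderiv 𝓘(ℝ, E₀) (modelT' E k)
      (Subtype.val : range (legendre L) → KCotangentBundle (E := E) k Q) p)

/-- Surjectivity of the differential of `legendre₀ L` makes testing against all vectors of `T¹ₖQ`
the same as testing against all tangent vectors of `P₀`. Every tangent space of `P₀` is `E₀`, so the
index in `E₀` runs over all of them at each `p`; no smoothness of the forms in `p` is needed. -/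
theorem cartanKernel_eq (hL : IsAlmostRegular L E₀) :
    cartanKernel L =
      liftedDistribution (modelT E k) 𝓘(ℝ, E₀) (legendre₀ L) (restrictedForm L E₀) := by
  obtain ⟨G, _, _, hC, -⟩ := hL.exists_submersionChart
  have key : ∀ α v z w, cartanTwoForm L α v z w =
      restrictedForm L E₀ (α, mfderiv (modelT E k) 𝓘(ℝ, E₀) (legendre₀ L) v w) (legendre₀ L v)
        (mfderiv (modelT E k) 𝓘(ℝ, E₀) (legendre₀ L) v z) := by
    intro α v z w
    rw [cartanTwoForm_eq hL.contMDiff hL.contMDiff_legendre, hL.mfderiv_legendre,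
      hL.mfderiv_legendre]
    rfl
  ext Z
  refine and_congr_right fun _ => ⟨fun h i v => ?_, fun h α v w => ?_⟩
  · obtain ⟨C⟩ := hC v
    obtain ⟨w, hw⟩ := C.mfderiv_surjective C.mem i.2
    have := key i.1 v (Z v) w
    rw [h, hw] at this
    exact this.symm
  · rw [key]
    exact h _ v

/-- Vectors killed by the differential of `legendre₀ L` are killed by that of `legendre L`, hence by
`dE_L`; connected fibres make the energy descend. -/
theorem isProjectableFunction_energy (hL : IsAlmostRegular L E₀) :
    IsProjectableFunction 𝓘(ℝ, E₀) (legendre₀ L) (energy L) := by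
  obtain ⟨G, _, _, hC, -⟩ := hL.exists_submersionChart
  refine isProjectableFunction_of_mfderiv_eq_zero hC rangeFactorization_surjective (fun p => ?_)
    (contMDiff_energy hL.contMDiff hL.contMDiff_legendre) (fun v z hz => ?_)
  · have h : legendre₀ L ⁻¹' {p} = legendre L ⁻¹' {p.1} := by
      ext v
      exact Subtype.ext_iff
    rw [h]
    exact (hL.isConnected_fiber p.1 p.2).isPreconnected
  · refine differential_energy_eq_zero hL.contMDiff hL.contMDiff_legendre v z ?_
    rw [hL.mfderiv_legendre, hz]
    exact (mfderiv 𝓘(ℝ, E₀) (modelT' E k) (Subtype.val : range (legendre L) → _)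
      (legendre₀ L v)).map_zero

/-- If the energy is `g ∘ FL₀` and `Z` is related to `Y`, the chain rule gives `i(Z) dE_L = Y(g) ∘
FL₀`. -/
theorem isProjectableFunction_dynamicalConstraint [IsManifold 𝓘(ℝ, E₀) ∞ (range (legendre L))]
    (hL : IsAlmostRegular L E₀)
    {Z : ∀ v : KTangentBundle (E := E) k Q, TangentSpace (modelT E k) v}
    (hZ : IsProjectableVectorField (modelT E k) 𝓘(ℝ, E₀) (legendre₀ L) Z) :
    IsProjectableFunction 𝓘(ℝ, E₀) (legendre₀ L) (dynamicalConstraint L Z) := by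
  obtain ⟨Y, hY, hZY⟩ := hZ
  obtain ⟨g, hg, hgE⟩ := hL.isProjectableFunction_energy
  refine ⟨fun p => mfderiv 𝓘(ℝ, E₀) 𝓘(ℝ, ℝ) g p (Y p), ?_, ?_⟩
  · exact contMDiffOn_univ.1 (contMDiffOn_mfderiv_apply isOpen_univ hg.contMDiffOn hY.contMDiffOn)
  · ext v
    have h := congrArg (fun T => T (Z v)) (mfderiv_comp v
      (hg.mdifferentiable (by simp) (legendre₀ L v))
      (hL.contMDiff_legendre₀.mdifferentiable (by simp) v))
    rw [← hgE] at h
    refine h.trans ?_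
    exact congrArg (mfderiv 𝓘(ℝ, E₀) 𝓘(ℝ, ℝ) g (legendre₀ L v)) (hZY v)

variable [T2Space Q] [SecondCountableTopology Q] [FiniteDimensional ℝ E₀]
  [IsManifold 𝓘(ℝ, E₀) ∞ (range (legendre L))]

theorem exists_projectable_eq (hL : IsAlmostRegular L E₀)
    {Z : ∀ v : KTangentBundle (E := E) k Q, TangentSpace (modelT E k) v}
    (hZ : Z ∈ cartanKernel L) (v : KTangentBundle (E := E) k Q) :
    ∃ W ∈ cartanKernel L, W v = Z v ∧
      IsProjectableVectorField (modelT E k) 𝓘(ℝ, E₀) (legendre₀ L) W := by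
  obtain ⟨G, _, _, hC, hG⟩ := hL.exists_submersionChart
  have := hG ⟨v⟩
  have := t2Space_kTangentBundle (E := E) k Q
  -- As a subspace of a Hausdorff space `P₀` is Hausdorff, which its bump functions require.
  have := t2Space_kCotangentBundle (E := E) k Q
  have := sigmaCompactSpace_kTangentBundle (E := E) k Q
  rw [hL.cartanKernel_eq] at hZ ⊢
  obtain ⟨W, hW, hWp, n, h, β, U, -, hv, -, -, hβ, hsum⟩ := exists_projectable_add_sum hC hZ v
  refine ⟨W, hW, ?_, hWp⟩
  -- All coefficients of the remainder vanish at `v`.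
  rw [hsum v hv]
  simp [hβ]

theorem exists_projectable_generators (hL : IsAlmostRegular L E₀)
    {U : Set (KTangentBundle (E := E) k Q)} (hU : IsOpen U) {v : KTangentBundle (E := E) k Q}
    (hv : v ∈ U) {r : ℕ}
    {Z : Fin r → ∀ w : KTangentBundle (E := E) k Q, TangentSpace (modelT E k) w}
    (hZ : GeneratesKernelOn L Z U) :
    ∃ U' ⊆ U, IsOpen U' ∧ v ∈ U' ∧
      ∃ W : Fin r → ∀ w : KTangentBundle (E := E) k Q, TangentSpace (modelT E k) w,
        GeneratesKernelOn L W U' ∧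
        ∀ i, IsProjectableVectorField (modelT E k) 𝓘(ℝ, E₀) (legendre₀ L) (W i) := by
  obtain ⟨G, _, _, hC, hG⟩ := hL.exists_submersionChart
  have := hG ⟨v⟩
  have := t2Space_kTangentBundle (E := E) k Q
  have := t2Space_kCotangentBundle (E := E) k Q
  have := sigmaCompactSpace_kTangentBundle (E := E) k Q
  unfold GeneratesKernelOn at hZ ⊢
  rw [hL.cartanKernel_eq] at hZ ⊢
  obtain ⟨U', hU'U, hU', hvU', W, hW, hWp, hgen⟩ :=
    KSymplectic.exists_projectable_generators hC hZ.1 hU hZ.2 hv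
  exact ⟨U', hU'U, hU', hvU', W, ⟨hW, hgen⟩, hWp⟩

end IsAlmostRegular

end AlmostRegular

end KSymplectic

theorem mainTheorem4
    {E : Type*} [NormedAddCommGroup E] [NormedSpace ℝ E] [FiniteDimensional ℝ E]
    {k : ℕ} {Q : Type*} [TopologicalSpace Q] [T2Space Q] [SecondCountableTopology Q]
    [ChartedSpace E Q] [IsManifold 𝓘(ℝ, E) ∞ Q]
    (L : KSymplectic.KTangentBundle (E := E) k Q → ℝ)
    {E₀ : Type*} [NormedAddCommGroup E₀] [NormedSpace ℝ E₀] [FiniteDimensional ℝ E₀]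
    [ChartedSpace E₀ (range (KSymplectic.legendre L))]
    [IsManifold 𝓘(ℝ, E₀) ∞ (range (KSymplectic.legendre L))]
    (hL : KSymplectic.IsAlmostRegular L E₀) :
    -- constraints of projectable kernel fields are projectable functions
    (∀ Z ∈ KSymplectic.cartanKernel L,
      KSymplectic.IsProjectableVectorField (KSymplectic.modelT E k) 𝓘(ℝ, E₀)
        (KSymplectic.legendre₀ L) Z →
      KSymplectic.IsProjectableFunction 𝓘(ℝ, E₀) (KSymplectic.legendre₀ L)
        (KSymplectic.dynamicalConstraint L Z)) ∧
    -- at each point, every kernel field takes the value of a projectable kernel field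
    (∀ Z ∈ KSymplectic.cartanKernel L, ∀ v, ∃ Z' ∈ KSymplectic.cartanKernel L,
      Z' v = Z v ∧
      KSymplectic.IsProjectableVectorField (KSymplectic.modelT E k) 𝓘(ℝ, E₀)
        (KSymplectic.legendre₀ L) Z' ∧
      KSymplectic.IsProjectableFunction 𝓘(ℝ, E₀) (KSymplectic.legendre₀ L)
        (KSymplectic.dynamicalConstraint L Z')) ∧
    -- the projectable constraints define the same set as all constraints
    ({v | ∀ Z ∈ KSymplectic.cartanKernel L, KSymplectic.dynamicalConstraint L Z v = 0} =
      {v | ∀ Z ∈ KSymplectic.cartanKernel L,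
        KSymplectic.IsProjectableFunction 𝓘(ℝ, E₀) (KSymplectic.legendre₀ L)
          (KSymplectic.dynamicalConstraint L Z) →
        KSymplectic.dynamicalConstraint L Z v = 0}) ∧
    -- local generators of the kernel, hence of the constraints, can be chosen projectable
    (∀ (v : KSymplectic.KTangentBundle (E := E) k Q)
      (U : Set (KSymplectic.KTangentBundle (E := E) k Q)), IsOpen U → v ∈ U →
      ∀ (r : ℕ) (Z : Fin r → ∀ w : KSymplectic.KTangentBundle (E := E) k Q,
        TangentSpace (KSymplectic.modelT E k) w),
      KSymplectic.GeneratesKernelOn L Z U →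
      ∃ U' ⊆ U, IsOpen U' ∧ v ∈ U' ∧
        ∃ W : Fin r → ∀ w : KSymplectic.KTangentBundle (E := E) k Q,
          TangentSpace (KSymplectic.modelT E k) w,
        KSymplectic.GeneratesKernelOn L W U' ∧
        (∀ i, KSymplectic.IsProjectableVectorField (KSymplectic.modelT E k) 𝓘(ℝ, E₀)
          (KSymplectic.legendre₀ L) (W i)) ∧
        (∀ i, KSymplectic.IsProjectableFunction 𝓘(ℝ, E₀) (KSymplectic.legendre₀ L)
          (KSymplectic.dynamicalConstraint L (W i))) ∧
        ∀ X ∈ KSymplectic.cartanKernel L,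
          ∃ c : Fin r → KSymplectic.KTangentBundle (E := E) k Q → ℝ,
            (∀ i, ContMDiffOn (KSymplectic.modelT E k) 𝓘(ℝ, ℝ) ∞ (c i) U') ∧
            ∀ w ∈ U', KSymplectic.dynamicalConstraint L X w =
              ∑ i, c i w * KSymplectic.dynamicalConstraint L (W i) w) := by
  have h1 : ∀ Z ∈ KSymplectic.cartanKernel L, ∀ v, ∃ Z' ∈ KSymplectic.cartanKernel L,
      Z' v = Z v ∧
      KSymplectic.IsProjectableVectorField (KSymplectic.modelT E k) 𝓘(ℝ, E₀)
        (KSymplectic.legendre₀ L) Z' ∧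
      KSymplectic.IsProjectableFunction 𝓘(ℝ, E₀) (KSymplectic.legendre₀ L)
        (KSymplectic.dynamicalConstraint L Z') := by
    intro Z hZ v
    obtain ⟨W, hW, hWv, hWp⟩ := hL.exists_projectable_eq hZ v
    exact ⟨W, hW, hWv, hWp, hL.isProjectableFunction_dynamicalConstraint hWp⟩
  refine ⟨fun Z _ hZ => hL.isProjectableFunction_dynamicalConstraint hZ, h1, ?_, ?_⟩
  · refine Subset.antisymm (fun v hv Z hZ _ => hv Z hZ) fun v hv Z hZ => ?_
    -- The constraint at `v` depends only on the value of the field at `v`, so `Z` may be exchanged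
    -- for a projectable field with the same value.
    obtain ⟨W, hW, hWv, -, hWp⟩ := h1 Z hZ v
    have h := hv W hW hWp
    rwa [KSymplectic.dynamicalConstraint, hWv] at h
  · intro v U hU hv r Z hZ
    obtain ⟨U', hU'U, hU', hvU', W, hW, hWp⟩ := hL.exists_projectable_generators hU hv hZ
    refine ⟨U', hU'U, hU', hvU', W, hW, hWp,
      fun i => hL.isProjectableFunction_dynamicalConstraint (hWp i), fun X hX => ?_⟩
    -- The constraint is linear over functions in the field, so the coefficients expressing `X` also
    -- express its constraint.
    obtain ⟨c, hc, hsum⟩ := hW.2 X hX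
    refine ⟨c, hc, fun w hw => ?_⟩
    simp only [KSymplectic.dynamicalConstraint]
    rw [hsum w hw, map_sum]
    simp only [map_smul, smul_eq_mul]
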